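/- Let $S$ be a connected smooth manifold (without boundary) of finite dimension $m\ge 2$, endowed with a smooth Riemannian metric $g_0$, a smooth one-form $\omega$ with $\omega_x\neq 0$ for all $x\in S$, and a smooth function $\Lambda:S\to[0,+\infty)$. For $\varepsilon\ge 0$ consider on $S\times\mathbb R$ (with $t$ the coordinate on $\mathbb R$) the Lorentzian metric $$g_\varepsilon=g_0+\omega\otimes dt+dt\otimes\omega-(\Lambda+\varepsilon)\,dt^2,$$ and let $g=g_0+\omega\otimes dt+dt\otimes\omega-\Lambda\,dt^2$ be the metric obtained for $\varepsilon=0$. A causal vector $w$ (i.e. $w\ne 0$, non-positive square) is future-pointing if $dt(w)>0$. For $\varepsilon>0$ let $$F_\varepsilon(v)=\frac{g_0(v,v)}{-\omega(v)+\sqrt{(\Lambda+\varepsilon)g_0(v,v)+\omega(v)^2}}\quad(v\neq0),\qquad F_\varepsilon(0)=0,$$ let $d_\varepsilon(x,y)$ be the infimum of the lengths $\int_0^1F_\varepsilon(\dot c)\,ds$ over the continuous piecewise smooth curves $c:[0,1]\to S$ from $x$ to $y$, and let $B^+_\varepsilon(x,r)=\{y: d_\varepsilon(x,y)<r\}$ and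 $B^-_\varepsilon(x,r)=\{y: d_\varepsilon(y,x)<r\}$ be the forward and backward balls. Assume $(\star)$ there exists $\bar\varepsilon\in(0,1]$ such that $\overline{B^+_{\bar\varepsilon}(x,r)}\cap\overline{B^-_{\bar\varepsilon}(y,s)}$ is compact for all $x,y\in S$ and all $r,s>0$. A pregeodesic is a smooth curve that has an (increasing, regular, smooth) reparametrization as a geodesic; it is lightlike if its velocity is everywhere a nonzero null vector. Let $x_0,x_1\in S$, $t_0\in\mathbb R$, $\varepsilon_n>0$ with $\varepsilon_n\to0$, and $\Delta_n>0$ with $\Delta_n\to\Delta\in\mathbb R$. For each $n\in\mathbb N$ let $\gamma_n:[t_0,t_0+\Delta_n]\to S\times\mathbb R$, $\gamma_n(t)=(\sigma_n(t),t)$, be a lightlike pregeodesic of $g_{\varepsilon_n}$ with $\gamma_n(t_0)=(x_0,t_0)$ and $\gamma_n(t_0+\Delta_n)=(x_1,t_0+\Delta_n)$. Then there is a subsequence of $\{\gamma_n\}$ that converges uniformly to a curve $\gamma:[t_0,t_0+\Delta]\to S\times\mathbb R$, $\gamma(t)=(\sigma(t),t)$, which is a future-pointing lightlike pregeodesic of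 $g$ from $(x_0,t_0)$ to $(x_1,t_0+\Delta)$. Since the intervals of definition vary, uniform convergence means uniform convergence on $[t_0,+\infty)$, with respect to the distance induced by $g_0\oplus dt^2$, after extending each $\sigma_n$ by $x_1$ for $t\ge t_0+\Delta_n$ and $\sigma$ by $x_1$ for $t\ge t_0+\Delta$. -/

import Mathlib

open Set Filter Topology Bundle
open scoped Manifold ContDiff ENNReal

noncomputable section

/-! ### Geodesics of a (pseudo-Riemannian) metric tensor

`M` is a manifold without boundary and `g` a field of symmetric bilinear forms on its tangent
spaces. -/

section Geodesics

variable {E : Type*} [NormedAddCommGroup E] [NormedSpace ℝ E]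
  {H : Type*} [TopologicalSpace H] {I : ModelWithCorners ℝ E H}
  {M : Type*} [TopologicalSpace M] [ChartedSpace H M]

/-- The components of `g` in the chart `φ = extChartAt I p`: at the point `x` of the target of `φ`
this is the pulled back bilinear form `(v, w) ↦ g (d(φ⁻¹)ₓ v, d(φ⁻¹)ₓ w)`. -/
def metricInChart (g : ∀ q : M, LinearMap.BilinForm ℝ (TangentSpace I q)) (p : M)
    (x v w : E) : ℝ :=
  g ((extChartAt I p).symm x)
    (mfderiv 𝓘(ℝ, E) I (extChartAt I p).symm x v)
    (mfderiv 𝓘(ℝ, E) I (extChartAt I p).symm x w)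

/-- The Christoffel symbols of the first kind of the Levi-Civita connection of `g` in the chart at
`p`: `Γ(v, w; z) = (∂_v g(w, z) + ∂_w g(v, z) - ∂_z g(v, w)) / 2`. -/
def christoffelInChart (g : ∀ q : M, LinearMap.BilinForm ℝ (TangentSpace I q)) (p : M)
    (x v w z : E) : ℝ :=
  (fderiv ℝ (fun y => metricInChart g p y w z) x v
    + fderiv ℝ (fun y => metricInChart g p y v z) x w
    - fderiv ℝ (fun y => metricInChart g p y v w) x z) / 2

/-- `γ` restricted to `[a, b]` is a geodesic of `g`: it is smooth on `[a, b]` and in every chart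
its coordinate expression `u` satisfies the geodesic equation of the Levi-Civita connection,
written with the index lowered by the (nondegenerate) form `g`:
`g(u'', z) + Γ(u', u'; z) = 0` for all `z`. -/
def IsGeodesicOn (g : ∀ q : M, LinearMap.BilinForm ℝ (TangentSpace I q)) (γ : ℝ → M)
    (a b : ℝ) : Prop :=
  ContMDiffOn 𝓘(ℝ, ℝ) I ∞ γ (Icc a b) ∧
    ∀ p : M, ∀ s ∈ Icc a b, γ s ∈ (chartAt H p).source →
      ∀ u : ℝ → E, u = (fun r => extChartAt I p (γ r)) →
        ∀ z : E,
          metricInChart g p (u s) (derivWithin (derivWithin u (Icc a b)) (Icc a b) s) z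
            + christoffelInChart g p (u s) (derivWithin u (Icc a b) s)
                (derivWithin u (Icc a b) s) z = 0

/-- `γ` restricted to `[a, b]` is a pregeodesic of `g`: a smooth curve that has a reparametrization
`γ ∘ h`, with `h : [c, d] → [a, b]` an increasing smooth diffeomorphism, which is a geodesic. -/
def IsPregeodesicOn (g : ∀ q : M, LinearMap.BilinForm ℝ (TangentSpace I q)) (γ : ℝ → M)
    (a b : ℝ) : Prop :=
  ContMDiffOn 𝓘(ℝ, ℝ) I ∞ γ (Icc a b) ∧
    ∃ (c d : ℝ) (h : ℝ → ℝ), c < d ∧ h c = a ∧ h d = b ∧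
      ContDiffOn ℝ ∞ h (Icc c d) ∧ (∀ s ∈ Icc c d, 0 < derivWithin h (Icc c d) s) ∧
      IsGeodesicOn g (γ ∘ h) c d

variable (I) in
/-- The velocity at time `s` of a curve defined on `[a, b]` (one-sided at the end points). -/
def velocityOn (γ : ℝ → M) (a b s : ℝ) : TangentSpace I (γ s) :=
  mfderivWithin 𝓘(ℝ, ℝ) I γ (Icc a b) s (1 : ℝ)

/-- `γ` restricted to `[a, b]` is lightlike for `g`: its velocity is a nonzero null vector. -/
def IsLightlikeOn (g : ∀ q : M, LinearMap.BilinForm ℝ (TangentSpace I q)) (γ : ℝ → M)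
    (a b : ℝ) : Prop :=
  ∀ s ∈ Icc a b, velocityOn I γ a b s ≠ 0 ∧
    g (γ s) (velocityOn I γ a b s) (velocityOn I γ a b s) = 0

end Geodesics

/-! ### The metrics `g_ε` on `S × ℝ` and the Randers metrics `F_ε` on `S` -/

section Stationary

variable {E : Type*} [NormedAddCommGroup E] [NormedSpace ℝ E]
  {S : Type*} [TopologicalSpace S] [ChartedSpace E S]

variable (E) in
/-- The projection `T_(x,t)(S × ℝ) → T_x S`. -/
def spacePart (p : S × ℝ) :
    TangentSpace (𝓘(ℝ, E).prod 𝓘(ℝ, ℝ)) p →ₗ[ℝ] TangentSpace 𝓘(ℝ, E) p.1 :=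
  (mfderiv (𝓘(ℝ, E).prod 𝓘(ℝ, ℝ)) 𝓘(ℝ, E) (Prod.fst : S × ℝ → S) p).toLinearMap

variable (E) in
/-- The one-form `dt` on `S × ℝ`. -/
def timeForm (p : S × ℝ) : TangentSpace (𝓘(ℝ, E).prod 𝓘(ℝ, ℝ)) p →ₗ[ℝ] ℝ :=
  (mfderiv (𝓘(ℝ, E).prod 𝓘(ℝ, ℝ)) 𝓘(ℝ, ℝ) (Prod.snd : S × ℝ → ℝ) p).toLinearMap

variable [RiemannianBundle (fun x : S => TangentSpace 𝓘(ℝ, E) x)]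

/-- `g_ε = g₀ + η ⊗ dt + dt ⊗ η - (Λ + ε) dt²` on `S × ℝ`, where `g₀` is the Riemannian metric
of `S`. The metric `g` is the case `ε = 0`. -/
def stationaryMetric (η : ∀ x : S, TangentSpace 𝓘(ℝ, E) x →L[ℝ] ℝ) (Λ : S → ℝ) (ε : ℝ)
    (p : S × ℝ) : LinearMap.BilinForm ℝ (TangentSpace (𝓘(ℝ, E).prod 𝓘(ℝ, ℝ)) p) :=
  (innerₗ (TangentSpace 𝓘(ℝ, E) p.1)).compl₁₂ (spacePart E p) (spacePart E p)
    + LinearMap.BilinForm.linMulLin ((η p.1).toLinearMap ∘ₗ spacePart E p) (timeForm E p)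
    + LinearMap.BilinForm.linMulLin (timeForm E p) ((η p.1).toLinearMap ∘ₗ spacePart E p)
    - (Λ p.1 + ε) • LinearMap.BilinForm.linMulLin (timeForm E p) (timeForm E p)

/-- A curve in `S × ℝ`, restricted to `[a, b]`, is future-pointing (and causal) for `g`: its
velocity `w` is nonzero with `g(w, w) ≤ 0` and `dt(w) > 0`. -/
def IsFuturePointingOn
    (g : ∀ p : S × ℝ, LinearMap.BilinForm ℝ (TangentSpace (𝓘(ℝ, E).prod 𝓘(ℝ, ℝ)) p))
    (γ : ℝ → S × ℝ) (a b : ℝ) : Prop :=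
  ∀ s ∈ Icc a b, velocityOn (𝓘(ℝ, E).prod 𝓘(ℝ, ℝ)) γ a b s ≠ 0 ∧
    g (γ s) (velocityOn (𝓘(ℝ, E).prod 𝓘(ℝ, ℝ)) γ a b s)
      (velocityOn (𝓘(ℝ, E).prod 𝓘(ℝ, ℝ)) γ a b s) ≤ 0 ∧
    0 < timeForm E (γ s) (velocityOn (𝓘(ℝ, E).prod 𝓘(ℝ, ℝ)) γ a b s)

/-- The Randers metric `F_ε(v) = g₀(v,v) / (-η(v) + √((Λ + ε) g₀(v,v) + η(v)²))`, for `ε > 0`;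
its value at `v = 0` is `0`. -/
def randersNorm (η : ∀ x : S, TangentSpace 𝓘(ℝ, E) x →L[ℝ] ℝ) (Λ : S → ℝ) (ε : ℝ)
    (x : S) (v : TangentSpace 𝓘(ℝ, E) x) : ℝ :=
  inner ℝ v v / (-(η x v) + √((Λ x + ε) * inner ℝ v v + (η x v) ^ 2))

variable (E) in
/-- `c` restricted to `[0, 1]` is a continuous piecewise smooth curve from `x` to `y`. -/
def IsPiecewiseSmoothPath (x y : S) (c : ℝ → S) : Prop :=
  ContinuousOn c (Icc 0 1) ∧ c 0 = x ∧ c 1 = y ∧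
    ∃ (k : ℕ) (s : ℕ → ℝ), s 0 = 0 ∧ s k = 1 ∧ (∀ i < k, s i < s (i + 1)) ∧
      ∀ i < k, ContMDiffOn 𝓘(ℝ, ℝ) 𝓘(ℝ, E) ∞ c (Icc (s i) (s (i + 1)))

/-- The `F_ε`-length of a piecewise smooth curve defined on `[0, 1]`. -/
def randersLength (η : ∀ x : S, TangentSpace 𝓘(ℝ, E) x →L[ℝ] ℝ) (Λ : S → ℝ) (ε : ℝ)
    (c : ℝ → S) : ℝ≥0∞ :=
  ∫⁻ s in Ioo (0 : ℝ) 1,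
    ENNReal.ofReal (randersNorm η Λ ε (c s) (mfderiv 𝓘(ℝ, ℝ) 𝓘(ℝ, E) c s (1 : ℝ)))

/-- The (non-symmetric) distance `d_ε` of `F_ε`: the infimum of the lengths of the piecewise
smooth curves from `x` to `y`. -/
def randersDist (η : ∀ x : S, TangentSpace 𝓘(ℝ, E) x →L[ℝ] ℝ) (Λ : S → ℝ) (ε : ℝ)
    (x y : S) : ℝ≥0∞ :=
  ⨅ (c : ℝ → S) (_ : IsPiecewiseSmoothPath E x y c), randersLength η Λ ε c

/-- The forward ball `B_ε⁺(x, r)`. -/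
def forwardBall (η : ∀ x : S, TangentSpace 𝓘(ℝ, E) x →L[ℝ] ℝ) (Λ : S → ℝ) (ε : ℝ)
    (x : S) (r : ℝ) : Set S :=
  {y | randersDist η Λ ε x y < ENNReal.ofReal r}

/-- The backward ball `B_ε⁻(x, r)`. -/
def backwardBall (η : ∀ x : S, TangentSpace 𝓘(ℝ, E) x →L[ℝ] ℝ) (Λ : S → ℝ) (ε : ℝ)
    (x : S) (r : ℝ) : Set S :=
  {y | randersDist η Λ ε y x < ENNReal.ofReal r}

/-- Condition (⋆): for some `ε ∈ (0, 1]` all the intersections of a closed forward ball and a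
closed backward ball of `F_ε` are compact. -/
def StarCondition (η : ∀ x : S, TangentSpace 𝓘(ℝ, E) x →L[ℝ] ℝ) (Λ : S → ℝ) : Prop :=
  ∃ ε ∈ Ioc (0 : ℝ) 1, ∀ (x y : S) (r s : ℝ), 0 < r → 0 < s →
    IsCompact (closure (forwardBall η Λ ε x r) ∩ closure (backwardBall η Λ ε y s))

end Stationary

end

/-!
The theorem holds because light rays of the form `t ↦ (σ(t), t)` solve a second order ordinary
differential equation that depends smoothly on `ε ≥ 0`, including `ε = 0`, and because condition
(⋆) confines all the curves to a compact set.

*Equation.* In a chart, the Lorentzian form `lorentzForm g η Λ ε` is invertible for every `ε ≥ 0`,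
since `η` does not vanish. The geodesic equation of the graph `(σ(t), t)`, in an affine parameter
`s` with `t = h(s)`, splits into `σ'' = rayField (σ, σ', ε)` and `h'' = κ(h) h'²`, where `rayField`
and `κ` are smooth functions of `(σ, σ', ε)` (`geodesicEquation_iff`). Thus a pregeodesic is the
same as a solution of the first equation (`IsPregeodesicOn.exists_solvesRayEquation`,
`SolvesRayEquation.isPregeodesicOn`); the second can always be solved for `h`
(`exists_reparametrization`). The graph is null iff `g₀(σ', σ') + 2 η(σ') = Λ + ε`
(`HasNullGraph`), which bounds `σ'` over compact sets uniformly in `ε ≤ 1`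
(`exists_norm_le_of_null`).

*Confinement.* For `ε ≤ δ` the `F_δ`-length of `σ` is at most the elapsed time, so with `δ` from
(⋆) the curves `σ n` eventually lie in the intersection of two closed balls
(`mem_forwardBall_inter_backwardBall`), which is compact. They are therefore uniformly Lipschitz,
and after rescaling to `[0, 1]` a subsequence converges uniformly by the Arzelà–Ascoli theorem.

*Limit.* In a chart, velocities and accelerations of the curves are bounded, so the velocities also
converge and the equation passes to the limit (`exists_limit_of_second_order_solutions`); so do the
null condition and the rates `κ`. Velocities of the limit are nonzero and future-pointing because
their `t`-component is `1`.

*Positive duration.* If the limit duration were `0`, the end points would coincide and the curves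
would be loops, of arbitrarily small duration, in a single chart. This is excluded by
`exists_pos_le_duration_of_loop`. The energy `Λ + ε - η(σ')` of a ray satisfies a linear
differential equation, hence is nearly constant, of order `M`, over a short time `T`. As `Λ + ε` is
at most of this order, velocities and accelerations are `O(√M)` (a nonnegative function bounds the
square of its gradient, `exists_norm_fderiv_le_mul_sqrt`). Since a loop returns to its base point
`y`, its velocities are even `O(√M T)`, and `η_y(σ')` vanishes at some time. The energy, which is
`g₀(σ', σ') + η(σ')`, is then `O(M T)` at that time; as it is also of order `M`, small `T` are
impossible.
-/

noncomputable section

/-! ### Limits and regularity of solutions of differential equations -/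

/-- A curve whose derivative at `r` differs from its derivative at `s` by at most `B * |r - s|`
agrees with its tangent at `s` up to a quadratic error. -/
theorem norm_sub_sub_smul_le_of_hasDerivWithinAt {F : Type*} [NormedAddCommGroup F]
    [NormedSpace ℝ F] {J : Set ℝ} (hJ : Convex ℝ J) {x w : ℝ → F} {B : ℝ}
    (hx : ∀ r ∈ J, HasDerivWithinAt x (w r) J r) {s : ℝ} (hs : s ∈ J)
    (hw : ∀ r ∈ J, ‖w r - w s‖ ≤ B * |r - s|) {s' : ℝ} (hs' : s' ∈ J) :
    ‖x s' - x s - (s' - s) • w s‖ ≤ B * |s' - s| ^ 2 := by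
  have hsub : uIcc s s' ⊆ J := by
    rw [← segment_eq_uIcc]; exact hJ.segment_subset hs hs'
  have hB : 0 ≤ B * |s' - s| := (norm_nonneg _).trans (hw s' hs')
  rcases eq_or_ne s' s with rfl | hne
  · simp
  have hB0 : 0 ≤ B := by
    by_contra h
    have : 0 < |s' - s| := abs_pos.2 (sub_ne_zero.2 hne)
    nlinarith
  have key := (convex_uIcc s s').norm_image_sub_le_of_norm_hasDerivWithin_le
    (f := fun r => x r - r • w s) (f' := fun r => w r - w s) (C := B * |s' - s|)
    (fun r hr => by
      have h1 := (hx r (hsub hr)).mono hsub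
      have h2 := ((hasDerivWithinAt_id r (uIcc s s')).smul_const (w s))
      simpa [Pi.sub_def] using h1.sub h2)
    (fun r hr => (hw r (hsub hr)).trans (by
      have : |r - s| ≤ |s' - s| := abs_sub_left_of_mem_uIcc hr
      gcongr))
    left_mem_uIcc right_mem_uIcc
  have e : x s' - s' • w s - (x s - s • w s) = x s' - x s - (s' - s) • w s := by
    rw [sub_smul]; abel
  simp only [e] at key
  rw [Real.norm_eq_abs] at key
  calc _ ≤ _ := key
    _ = _ := by ring

theorem hasDerivWithinAt_of_norm_sub_sub_smul_le {F : Type*} [NormedAddCommGroup F]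
    [NormedSpace ℝ F] {J : Set ℝ} {x : ℝ → F} {v : F} {B s : ℝ}
    (h : ∀ s' ∈ J, ‖x s' - x s - (s' - s) • v‖ ≤ B * |s' - s| ^ 2) :
    HasDerivWithinAt x v J s := by
  rw [hasDerivWithinAt_iff_isLittleO]
  have h1 : (fun s' => x s' - x s - (s' - s) • v) =O[𝓝[J] s] fun s' => |s' - s| ^ 2 := by
    refine Asymptotics.IsBigO.of_bound B ?_
    filter_upwards [self_mem_nhdsWithin] with s' hs'
    simpa using h s' hs'
  refine h1.trans_isLittleO ?_
  have h2 : (fun s' : ℝ => (s' - s) ^ 2) =o[𝓝[J] s] fun s' => s' - s := by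
    have : Tendsto (fun s' : ℝ => s' - s) (𝓝[J] s) (𝓝 0) := by
      have : Tendsto (fun s' : ℝ => s' - s) (𝓝 s) (𝓝 (s - s)) :=
        (continuous_id.sub continuous_const).tendsto s
      simpa using this.mono_left nhdsWithin_le_nhds
    simpa [Function.comp_def] using
      (Asymptotics.isLittleO_pow_id (𝕜 := ℝ) (n := 2) (by norm_num)).comp_tendsto this
  simpa using h2

/-- If the derivatives of pointwise convergent curves are equi-Lipschitz, then they converge
pointwise as well, and their limit is the derivative of the limit. -/
theorem exists_tendsto_and_hasDerivWithinAt {F : Type*} [NormedAddCommGroup F]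
    [NormedSpace ℝ F] [CompleteSpace F] {J : Set ℝ} (hJ : Convex ℝ J) (hJ' : UniqueDiffOn ℝ J)
    {x w : ℕ → ℝ → F} {X : ℝ → F} {B : ℝ}
    (hx : ∀ n, ∀ r ∈ J, HasDerivWithinAt (x n) (w n r) J r)
    (hw : ∀ n, ∀ r ∈ J, ∀ s ∈ J, ‖w n r - w n s‖ ≤ B * |r - s|)
    (hX : ∀ s ∈ J, Tendsto (fun n => x n s) atTop (𝓝 (X s))) {s : ℝ} (hs : s ∈ J) :
    ∃ W, Tendsto (fun n => w n s) atTop (𝓝 W) ∧ HasDerivWithinAt X W J s := by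
  have quad : ∀ n, ∀ s' ∈ J, ‖x n s' - x n s - (s' - s) • w n s‖ ≤ B * |s' - s| ^ 2 :=
    fun n s' hs' => norm_sub_sub_smul_le_of_hasDerivWithinAt hJ (hx n) hs
      (fun r hr => hw n r hr s hs) hs'
  -- difference quotients with a small step approximate `w n s` uniformly in `n`
  have hcau : CauchySeq fun n => w n s := by
    rw [Metric.cauchySeq_iff']
    intro ε hε
    have hB : 0 ≤ |B| := abs_nonneg B
    obtain ⟨s', hs', hne, hlt⟩ : ∃ s' ∈ J, s' ≠ s ∧ |s' - s| < ε / (4 * (|B| + 1)) := by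
      have hacc := (hJ' s hs).accPt
      rw [accPt_iff_frequently] at hacc
      have hev : ∀ᶠ y in 𝓝 s, |y - s| < ε / (4 * (|B| + 1)) := by
        have := Metric.ball_mem_nhds s (show 0 < ε / (4 * (|B| + 1)) by positivity)
        filter_upwards [this] with y hy
        simpa [Real.dist_eq] using hy
      obtain ⟨y, ⟨h1, h2⟩, h3⟩ := (hacc.and_eventually hev).exists
      exact ⟨y, h2, h1, h3⟩
    have hpos : 0 < |s' - s| := abs_pos.2 (sub_ne_zero.2 hne)
    have hq : ∀ n, ‖w n s - (s' - s)⁻¹ • (x n s' - x n s)‖ ≤ ε / 4 := by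
      intro n
      have h1 : w n s - (s' - s)⁻¹ • (x n s' - x n s)
          = -((s' - s)⁻¹ • (x n s' - x n s - (s' - s) • w n s)) := by
        rw [smul_sub _ (x n s' - x n s), smul_smul, inv_mul_cancel₀ (sub_ne_zero.2 hne), one_smul]
        abel
      rw [h1, norm_neg, norm_smul, norm_inv, Real.norm_eq_abs]
      calc |s' - s|⁻¹ * ‖x n s' - x n s - (s' - s) • w n s‖
          ≤ |s' - s|⁻¹ * (B * |s' - s| ^ 2) := by gcongr; exact quad n s' hs'
        _ = B * |s' - s| := by field_simp
        _ ≤ (|B| + 1) * |s' - s| := by gcongr; linarith [le_abs_self B]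
        _ ≤ (|B| + 1) * (ε / (4 * (|B| + 1))) := by gcongr
        _ = ε / 4 := by field_simp
    have hqt : CauchySeq fun n => (s' - s)⁻¹ • (x n s' - x n s) :=
      (((hX s' hs').sub (hX s hs)).const_smul _).cauchySeq
    obtain ⟨N, hN⟩ := Metric.cauchySeq_iff'.1 hqt (ε / 4) (by positivity)
    refine ⟨N, fun n hn => ?_⟩
    have h2 := hN n hn
    have h3 := hq n
    have h4 := hq N
    rw [← dist_eq_norm] at h3 h4
    rw [dist_comm] at h4
    have := dist_triangle4 (w n s) _ _ (w N s) |>.trans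
      (add_le_add (add_le_add h3 h2.le) h4)
    linarith
  obtain ⟨W, hW⟩ := cauchySeq_tendsto_of_complete hcau
  refine ⟨W, hW, hasDerivWithinAt_of_norm_sub_sub_smul_le (B := B) fun s' hs' => ?_⟩
  exact le_of_tendsto ((((hX s' hs').sub (hX s hs)).sub (hW.const_smul (s' - s))).norm)
    (Eventually.of_forall fun n => quad n s' hs')

/-- Pointwise limits of solutions of `x' = d w`, `w' = d f(x, w, e)` that stay in a fixed convex
compact set are solutions for the limits of the parameters `d ≠ 0` and `e`. -/
theorem exists_limit_of_second_order_solutions {F : Type*} [NormedAddCommGroup F]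
    [NormedSpace ℝ F] [CompleteSpace F] {J : Set ℝ} (hJ : Convex ℝ J) (hJ' : UniqueDiffOn ℝ J)
    {D : Set (F × F × ℝ)} (hD : IsCompact D) (hDc : Convex ℝ D) {f : F × F × ℝ → F}
    (hf : ContDiffOn ℝ 1 f D) {x w : ℕ → ℝ → F} {X : ℝ → F} {d e : ℕ → ℝ} {d₀ e₀ : ℝ}
    (hd : Tendsto d atTop (𝓝 d₀)) (hd₀ : d₀ ≠ 0) (he : Tendsto e atTop (𝓝 e₀))
    (hmem : ∀ n, ∀ s ∈ J, (x n s, w n s, e n) ∈ D)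
    (hx : ∀ n, ∀ r ∈ J, HasDerivWithinAt (x n) (d n • w n r) J r)
    (hw : ∀ n, ∀ r ∈ J, HasDerivWithinAt (w n) (d n • f (x n r, w n r, e n)) J r)
    (hX : ∀ s ∈ J, Tendsto (fun n => x n s) atTop (𝓝 (X s))) :
    ∃ W : ℝ → F, ∀ s ∈ J, Tendsto (fun n => w n s) atTop (𝓝 (W s)) ∧ (X s, W s, e₀) ∈ D ∧
      HasDerivWithinAt X (d₀ • W s) J s ∧
      HasDerivWithinAt W (d₀ • f (X s, W s, e₀)) J s := by
  obtain ⟨R, hR⟩ := hD.isBounded.exists_norm_le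
  obtain ⟨C, hC⟩ := hD.exists_bound_of_continuousOn hf.continuousOn
  obtain ⟨K, hK⟩ := hf.exists_lipschitzOnWith one_ne_zero hDc hD
  obtain ⟨δ, hδ⟩ := hd.norm.bddAbove_range
  have hδ : ∀ n, ‖d n‖ ≤ δ := fun n => hδ ⟨n, rfl⟩
  have hδ0 : 0 ≤ δ := (norm_nonneg _).trans (hδ 0)
  have hwR : ∀ n, ∀ s ∈ J, ‖w n s‖ ≤ R := fun n s hs =>
    ((norm_fst_le _).trans (norm_snd_le _)).trans (hR _ (hmem n s hs))
  have lipx : ∀ n, ∀ r ∈ J, ∀ s ∈ J, ‖x n r - x n s‖ ≤ δ * R * |r - s| := fun n r hr s hs => by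
    have := hJ.norm_image_sub_le_of_norm_hasDerivWithin_le (C := δ * R) (hx n)
      (fun r hr => by
        rw [norm_smul]
        exact mul_le_mul (hδ n) (hwR n r hr) (norm_nonneg _) hδ0) hs hr
    simpa using this
  have lipw : ∀ n, ∀ r ∈ J, ∀ s ∈ J, ‖w n r - w n s‖ ≤ δ * C * |r - s| := fun n r hr s hs => by
    have := hJ.norm_image_sub_le_of_norm_hasDerivWithin_le (C := δ * C) (hw n)
      (fun r hr => by
        rw [norm_smul]
        exact mul_le_mul (hδ n) (hC _ (hmem n r hr)) (norm_nonneg _) hδ0) hs hr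
    simpa using this
  have lipf : ∀ n, ∀ r ∈ J, ∀ s ∈ J,
      ‖d n • f (x n r, w n r, e n) - d n • f (x n s, w n s, e n)‖
        ≤ δ * (K * (δ * R + δ * C)) * |r - s| := fun n r hr s hs => by
    rw [← smul_sub, norm_smul, mul_assoc]
    refine mul_le_mul (hδ n) ?_ (norm_nonneg _) hδ0
    have h1 := hK.dist_le_mul _ (hmem n r hr) _ (hmem n s hs)
    rw [dist_eq_norm, dist_eq_norm] at h1
    refine h1.trans ?_
    rw [mul_assoc]
    refine mul_le_mul_of_nonneg_left ?_ K.2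
    have h2 := lipx n r hr s hs
    have h3 := lipw n r hr s hs
    have h4 : 0 ≤ δ * R * |r - s| := (norm_nonneg _).trans h2
    have h5 : 0 ≤ δ * C * |r - s| := (norm_nonneg _).trans h3
    simp only [Prod.mk_sub_mk, sub_self, Prod.norm_mk, norm_zero]
    refine max_le (by nlinarith) (max_le (by nlinarith) (by nlinarith))
  have lipv : ∀ n, ∀ r ∈ J, ∀ s ∈ J, ‖d n • w n r - d n • w n s‖ ≤ δ * (δ * C) * |r - s| :=
    fun n r hr s hs => by
      rw [← smul_sub, norm_smul, mul_assoc]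
      exact mul_le_mul (hδ n) (lipw n r hr s hs) (norm_nonneg _) hδ0
  have step1 : ∀ s, ∃ W, s ∈ J → Tendsto (fun n => w n s) atTop (𝓝 W) ∧
      HasDerivWithinAt X (d₀ • W) J s := by
    intro s
    by_cases hs : s ∈ J
    · -- the velocity of `x n` is `d n • w n s`; its limit is divided by `d₀`
      obtain ⟨V, hV, hV'⟩ := exists_tendsto_and_hasDerivWithinAt hJ hJ' hx lipv hX hs
      refine ⟨d₀⁻¹ • V, fun _ => ⟨?_, ?_⟩⟩
      · refine ((hd.inv₀ hd₀).smul hV).congr' ?_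
        filter_upwards [hd.eventually_ne hd₀] with n hn
        rw [smul_smul, inv_mul_cancel₀ hn, one_smul]
      · rwa [smul_smul, mul_inv_cancel₀ hd₀, one_smul]
    · exact ⟨0, fun h => (hs h).elim⟩
  choose W hW using step1
  have hmemlim : ∀ s ∈ J, (X s, W s, e₀) ∈ D := fun s hs =>
    hD.isClosed.mem_of_tendsto ((hX s hs).prodMk_nhds (((hW s hs).1).prodMk_nhds he))
      (Eventually.of_forall fun n => hmem n s hs)
  refine ⟨W, fun s hs => ⟨(hW s hs).1, hmemlim s hs, (hW s hs).2, ?_⟩⟩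
  obtain ⟨A, hA, hA'⟩ := exists_tendsto_and_hasDerivWithinAt hJ hJ' hw lipf
    (fun s hs => (hW s hs).1) hs
  have hlim : Tendsto (fun n => d n • f (x n s, w n s, e n)) atTop
      (𝓝 (d₀ • f (X s, W s, e₀))) := by
    refine hd.smul ?_
    refine (hf.continuousOn _ (hmemlim s hs)).tendsto.comp (tendsto_nhdsWithin_iff.2
      ⟨(hX s hs).prodMk_nhds (((hW s hs).1).prodMk_nhds he),
        Eventually.of_forall fun n => hmem n s hs⟩)
  rwa [tendsto_nhds_unique hA hlim] at hA'

/-- Solutions of an autonomous differential equation are as smooth as its right-hand side. -/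
theorem contDiffOn_infty_of_hasDerivWithinAt_comp {F : Type*} [NormedAddCommGroup F]
    [NormedSpace ℝ F] {J : Set ℝ} (hJ : UniqueDiffOn ℝ J) {y : ℝ → F} {Φ : F → F} {O : Set F}
    (hΦ : ContDiffOn ℝ ∞ Φ O) (hy : MapsTo y J O)
    (h : ∀ t ∈ J, HasDerivWithinAt y (Φ (y t)) J t) : ContDiffOn ℝ ∞ y J := by
  rw [contDiffOn_infty]
  intro n
  induction n with
  | zero =>
    exact contDiffOn_zero.2 fun t ht => (h t ht).continuousWithinAt
  | succ n ih =>
    rw [Nat.cast_add, Nat.cast_one, contDiffOn_succ_iff_derivWithin hJ]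
    refine ⟨fun t ht => (h t ht).differentiableWithinAt, by simp, ?_⟩
    have h1 : ContDiffOn ℝ n (fun t => Φ (y t)) J :=
      (hΦ.of_le (by exact_mod_cast le_top)).comp ih hy
    exact h1.congr fun t ht => (h t ht).derivWithin (hJ t ht)

/-- For every smooth `κ` on `[a, b]` there is an increasing smooth reparametrization `h` of
`[a, b]` with `h'' = κ(h) h'²`. -/
theorem exists_reparametrization {κ : ℝ → ℝ} {a b : ℝ} (hab : a < b)
    (hκ : ContDiffOn ℝ ∞ κ (Icc a b)) :
    ∃ (d : ℝ) (h : ℝ → ℝ), 0 < d ∧ h 0 = a ∧ h d = b ∧ ContDiffOn ℝ ∞ h (Icc 0 d) ∧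
      MapsTo h (Icc 0 d) (Icc a b) ∧ (∀ s ∈ Icc 0 d, 0 < derivWithin h (Icc 0 d) s) ∧
      ∀ s ∈ Icc 0 d, derivWithin (derivWithin h (Icc 0 d)) (Icc 0 d) s
        = κ (h s) * derivWithin h (Icc 0 d) s ^ 2 := by
  set κ' : ℝ → ℝ := IccExtend hab.le ((Icc a b).domRestrict κ) with hκ'
  have hκ'c : Continuous κ' :=
    (continuousOn_iff_continuous_domRestrict.1 hκ.continuousOn).Icc_extend'
  have hκ'e : ∀ t ∈ Icc a b, κ' t = κ t := fun t ht => by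
    simp [hκ', IccExtend_of_mem _ _ ht, Set.domRestrict]
  -- `q` is the prescribed speed of `h`, as a function of the value of `h`
  set q : ℝ → ℝ := fun t => Real.exp (∫ r in a..t, κ' r) with hq
  have hqd : ∀ t, HasDerivAt q (q t * κ' t) t := fun t =>
    ((hκ'c.integral_hasStrictDerivAt a t).hasDerivAt).exp
  have hqpos : ∀ t, 0 < q t := fun t => Real.exp_pos _
  have hqc : Continuous q := continuous_iff_continuousAt.2 fun t => (hqd t).continuousAt
  have hU : UniqueDiffOn ℝ (Icc a b) := uniqueDiffOn_Icc hab
  have hqs : ContDiffOn ℝ ∞ q (Icc a b) := by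
    rw [contDiffOn_infty]
    intro n
    induction n with
    | zero => exact contDiffOn_zero.2 hqc.continuousOn
    | succ n ih =>
      rw [Nat.cast_add, Nat.cast_one, contDiffOn_succ_iff_derivWithin hU]
      refine ⟨fun t _ => (hqd t).differentiableAt.differentiableWithinAt, by simp, ?_⟩
      refine (ih.mul (hκ.of_le (by exact_mod_cast le_top))).congr fun t ht => ?_
      rw [(hqd t).hasDerivWithinAt.derivWithin (hU t ht), hκ'e t ht]
  -- `k` is the inverse of `h`
  set k : ℝ → ℝ := fun t => ∫ r in a..t, (q r)⁻¹ with hk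
  have hqic : Continuous fun r => (q r)⁻¹ := hqc.inv₀ fun r => (hqpos r).ne'
  have hkd : ∀ t, HasDerivAt k (q t)⁻¹ t := fun t =>
    (hqic.integral_hasStrictDerivAt a t).hasDerivAt
  have hkmono : StrictMono k := strictMono_of_hasDerivAt_pos hkd fun t => inv_pos.2 (hqpos t)
  have hkc : Continuous k := continuous_iff_continuousAt.2 fun t => (hkd t).continuousAt
  have hka : k a = 0 := by simp [hk]
  have hd : 0 < k b := by rw [← hka]; exact hkmono hab
  have hsurj : SurjOn k (Icc a b) (Icc 0 (k b)) := by
    rw [← hka]; exact intermediate_value_Icc hab.le hkc.continuousOn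
  set h : ℝ → ℝ := Function.invFunOn k (Icc a b) with hh
  have hhm : MapsTo h (Icc 0 (k b)) (Icc a b) := hsurj.mapsTo_invFunOn
  have hkh : ∀ s ∈ Icc 0 (k b), k (h s) = s := fun s hs => hsurj.rightInvOn_invFunOn hs
  have hhk : ∀ t ∈ Icc a b, h (k t) = t := fun t ht =>
    hkmono.injective (hkh _ ⟨by rw [← hka]; exact hkmono.monotone ht.1, hkmono.monotone ht.2⟩)
  have hhd : ∀ s ∈ Icc 0 (k b), HasDerivWithinAt h (q (h s)) (Icc 0 (k b)) s := by
    intro s hs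
    obtain ⟨Q, hQ⟩ := isCompact_Icc.exists_bound_of_continuousOn (s := Icc a b) hqc.continuousOn
    have hQ0 : 0 < Q := (norm_pos_iff.2 (hqpos a).ne').trans_le (hQ a (left_mem_Icc.2 hab.le))
    have hexp : ∀ t ∈ Icc a b, ∀ t' ∈ Icc a b, t ≤ t' → Q⁻¹ * (t' - t) ≤ k t' - k t :=
      (convex_Icc a b).mul_sub_le_image_sub_of_le_deriv hkc.continuousOn
        (fun t _ => (hkd t).differentiableAt.differentiableWithinAt) fun t ht => by
          rw [(hkd t).deriv]
          exact inv_anti₀ (hqpos t) ((le_abs_self _).trans (hQ t (interior_subset ht)))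
    have hlip : LipschitzOnWith Q.toNNReal h (Icc 0 (k b)) := by
      refine LipschitzOnWith.of_le_add_mul _ fun s hs s' hs' => ?_
      rw [Real.coe_toNNReal _ hQ0.le, Real.dist_eq]
      rcases le_total (h s) (h s') with hle | hle
      · have : 0 ≤ Q * |s - s'| := by positivity
        linarith
      · have h1 := hexp _ (hhm hs') _ (hhm hs) hle
        rw [hkh s hs, hkh s' hs', inv_mul_le_iff₀ hQ0] at h1
        have := mul_le_mul_of_nonneg_left (le_abs_self (s - s')) hQ0.le
        linarith
    have hhc : ContinuousWithinAt h (Icc 0 (k b)) s := hlip.continuousOn s hs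
    rw [hasDerivWithinAt_iff_tendsto_slope]
    have hne : ∀ᶠ s' in 𝓝[Icc 0 (k b) \ {s}] s, h s' ≠ h s := by
      filter_upwards [self_mem_nhdsWithin] with s' hs' heq
      exact hs'.2 (by rw [mem_singleton_iff, ← hkh s' hs'.1, heq, hkh s hs])
    have h1 : Tendsto h (𝓝[Icc 0 (k b) \ {s}] s) (𝓝[≠] (h s)) :=
      tendsto_nhdsWithin_iff.2 ⟨hhc.tendsto.mono_left (nhdsWithin_mono _ sdiff_subset), hne⟩
    have h2 := ((hasDerivAt_iff_tendsto_slope.1 (hkd (h s))).comp h1).inv₀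
      (inv_ne_zero (hqpos _).ne')
    rw [inv_inv] at h2
    refine h2.congr' ?_
    filter_upwards [self_mem_nhdsWithin] with s' hs'
    simp only [Function.comp_apply, slope_def_field]
    rw [hkh s' hs'.1, hkh s hs, inv_div]
  have hU' : UniqueDiffOn ℝ (Icc 0 (k b)) := uniqueDiffOn_Icc hd
  have hhd' : ∀ s ∈ Icc 0 (k b), derivWithin h (Icc 0 (k b)) s = q (h s) := fun s hs =>
    (hhd s hs).derivWithin (hU' s hs)
  refine ⟨k b, h, hd, ?_, hhk b (right_mem_Icc.2 hab.le),
    contDiffOn_infty_of_hasDerivWithinAt_comp hU' hqs hhm hhd, hhm,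
    fun s hs => by rw [hhd' s hs]; exact hqpos _, fun s hs => ?_⟩
  · rw [← hka]; exact hhk a (left_mem_Icc.2 hab.le)
  · rw [derivWithin_congr hhd' (hhd' s hs), hhd' s hs]
    have := (hqd (h s)).comp_hasDerivWithinAt s (hhd s hs)
    rw [show (fun s => q (h s)) = q ∘ h from rfl, this.derivWithin (hU' s hs), hκ'e _ (hhm hs)]
    ring

/-! ### The equation of light rays in coordinates -/

section RayEquation

variable {E : Type*} [NormedAddCommGroup E] [NormedSpace ℝ E]

-- Shortcut instances: for these spaces the general search exceeds the default limits.
instance normedAddCommGroupCovectors : NormedAddCommGroup ((E × ℝ) →L[ℝ] ℝ) :=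
  ContinuousLinearMap.toNormedAddCommGroup

instance normedSpaceCovectors : NormedSpace ℝ ((E × ℝ) →L[ℝ] ℝ) :=
  ContinuousLinearMap.toNormedSpace

instance seminormedAddGroupMetrics : SeminormedAddGroup (E →L[ℝ] E →L[ℝ] ℝ) :=
  SeminormedAddCommGroup.toSeminormedAddGroup

/-- Coordinate expressions on the open set `U`, in the model space `E`, of a Riemannian metric `g`,
a one-form `η` without zeros and a function `Λ ≥ 0`. -/
structure IsStationaryData (U : Set E) (g : E → E →L[ℝ] E →L[ℝ] ℝ) (η : E → E →L[ℝ] ℝ)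
    (Λ : E → ℝ) : Prop where
  isOpen : IsOpen U
  contDiffOn_metric : ContDiffOn ℝ ∞ g U
  contDiffOn_form : ContDiffOn ℝ ∞ η U
  contDiffOn_fun : ContDiffOn ℝ ∞ Λ U
  symm : ∀ x ∈ U, ∀ v w, g x v w = g x w v
  pos : ∀ x ∈ U, ∀ v, v ≠ 0 → 0 < g x v v
  form_ne_zero : ∀ x ∈ U, η x ≠ 0
  fun_nonneg : ∀ x ∈ U, 0 ≤ Λ x

/-- The bilinear form `g + η ⊗ dt + dt ⊗ η - (Λ + ε) dt²` on `E × ℝ` at the point `x`. -/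
def lorentzForm (g : E → E →L[ℝ] E →L[ℝ] ℝ) (η : E → E →L[ℝ] ℝ) (Λ : E → ℝ) (ε : ℝ) (x : E) :
    (E × ℝ) →L[ℝ] (E × ℝ) →L[ℝ] ℝ :=
  (g x).bilinearComp (ContinuousLinearMap.fst ℝ E ℝ) (ContinuousLinearMap.fst ℝ E ℝ)
    + ((η x).comp (ContinuousLinearMap.fst ℝ E ℝ)).smulRight (ContinuousLinearMap.snd ℝ E ℝ)
    + (ContinuousLinearMap.snd ℝ E ℝ).smulRight ((η x).comp (ContinuousLinearMap.fst ℝ E ℝ))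
    - (Λ x + ε) • (ContinuousLinearMap.snd ℝ E ℝ).smulRight (ContinuousLinearMap.snd ℝ E ℝ)

variable {g : E → E →L[ℝ] E →L[ℝ] ℝ} {η : E → E →L[ℝ] ℝ} {Λ : E → ℝ} {U : Set E}

theorem lorentzForm_apply (ε : ℝ) (x : E) (v w : E × ℝ) :
    lorentzForm g η Λ ε x v w
      = g x v.1 w.1 + η x v.1 * w.2 + v.2 * η x w.1 - (Λ x + ε) * (v.2 * w.2) := by
  simp [lorentzForm]

variable (g η Λ) in
/-- The Christoffel symbol of the first kind `Γ(V, V; ·)` of `lorentzForm g η Λ ε`, for the vector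
`V = (w, 1)`. It does not depend on `ε`. -/
def forceForm (x w : E) : (E × ℝ) →L[ℝ] ℝ :=
  fderiv ℝ (lorentzForm g η Λ 0) x w (w, 1)
    - (1 / 2 : ℝ) • (((fderiv ℝ (lorentzForm g η Λ 0) x).flip (w, 1)).flip (w, 1)).comp
      (ContinuousLinearMap.fst ℝ E ℝ)

theorem forceForm_apply (x w : E) (z : E × ℝ) :
    forceForm g η Λ x w z = fderiv ℝ (lorentzForm g η Λ 0) x w (w, 1) z
      - (1 / 2) * fderiv ℝ (lorentzForm g η Λ 0) x z.1 (w, 1) (w, 1) := by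
  simp [forceForm]

variable (g η Λ) in
/-- The solution `A` of `⟨A, ·⟩ + Γ(V, V; ·) = 0` for `V = (w, 1)`, where `⟨·, ·⟩` is
`lorentzForm g η Λ ε x`. The triple is `(x, w, ε)`. -/
def rayAcc (q : E × E × ℝ) : E × ℝ :=
  -(lorentzForm g η Λ q.2.2 q.1).inverse (forceForm g η Λ q.1 q.2.1)

variable (g η Λ) in
/-- The right-hand side of the equation `x'' = f(x, x', ε)` of the light rays, parametrized by
`t`. -/
def rayField (q : E × E × ℝ) : E :=
  (rayAcc g η Λ q).1 - (rayAcc g η Λ q).2 • q.2.1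

variable [FiniteDimensional ℝ E]

theorem contDiffOn_lorentzForm_prod (h : IsStationaryData U g η Λ) :
    ContDiffOn ℝ ∞ (fun q : E × ℝ => lorentzForm g η Λ q.2 q.1) (U ×ˢ univ) := by
  have hm : MapsTo (Prod.fst : E × ℝ → E) (U ×ˢ univ) U := fun q hq => hq.1
  have hg := h.contDiffOn_metric.comp contDiffOn_fst hm
  have hη := h.contDiffOn_form.comp contDiffOn_fst hm
  have hΛ := h.contDiffOn_fun.comp contDiffOn_fst hm
  simp only [Function.comp_def] at hg hη hΛ
  refine contDiffOn_clm_apply.2 fun v => contDiffOn_clm_apply.2 fun w => ?_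
  simp only [lorentzForm_apply]
  have h1 := (hg.clm_apply (contDiffOn_const (c := v.1))).clm_apply (contDiffOn_const (c := w.1))
  have h2 := hη.clm_apply (contDiffOn_const (c := v.1))
  have h3 := hη.clm_apply (contDiffOn_const (c := w.1))
  exact ((h1.add (h2.mul contDiffOn_const)).add (contDiffOn_const.mul h3)).sub
    ((hΛ.add contDiffOn_snd).mul contDiffOn_const)

theorem contDiffOn_lorentzForm (h : IsStationaryData U g η Λ) (ε : ℝ) :
    ContDiffOn ℝ ∞ (lorentzForm g η Λ ε) U := by
  have h1 : ContDiffOn ℝ ∞ (fun x : E => (x, ε)) U := contDiffOn_id.prodMk contDiffOn_const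
  have h2 := (contDiffOn_lorentzForm_prod h).comp h1 fun _ hx => ⟨hx, mem_univ _⟩
  simpa only [Function.comp_def] using h2

/-- The derivatives of the components of `lorentzForm g η Λ ε` do not depend on `ε`. -/
theorem fderiv_lorentzForm_apply (h : IsStationaryData U g η Λ) {x : E} (hx : x ∈ U) (ε : ℝ)
    (v : E) (a b : E × ℝ) :
    fderiv ℝ (fun y => lorentzForm g η Λ ε y a b) x v
      = fderiv ℝ (lorentzForm g η Λ 0) x v a b := by
  have hd : DifferentiableAt ℝ (lorentzForm g η Λ 0) x :=
    ((contDiffOn_lorentzForm h 0).contDiffAt (h.isOpen.mem_nhds hx)).differentiableAt (by simp)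
  have e : (fun y => lorentzForm g η Λ ε y a b)
      = fun y => lorentzForm g η Λ 0 y a b - ε * (a.2 * b.2) := by
    ext y; simp only [lorentzForm_apply]; ring
  have := (hd.hasFDerivAt.clm_apply (hasFDerivAt_const a x)).clm_apply (hasFDerivAt_const b x)
  rw [e, (this.sub_const _).fderiv]
  simp

/-- `lorentzForm g η Λ ε x` is nondegenerate even where `Λ + ε` vanishes, because `η x ≠ 0`. -/
theorem lorentzForm_isInvertible (h : IsStationaryData U g η Λ) {x : E} (hx : x ∈ U) {ε : ℝ}
    (hε : 0 ≤ ε) : (lorentzForm g η Λ ε x).IsInvertible := by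
  have hinj : Function.Injective (lorentzForm g η Λ ε x).toLinearMap := by
    rw [injective_iff_map_eq_zero]
    rintro ⟨v, τ⟩ h0
    have h0' : ∀ z, lorentzForm g η Λ ε x (v, τ) z = 0 := fun z => by
      have : lorentzForm g η Λ ε x (v, τ) = 0 := h0
      rw [this]; rfl
    have h1 := h0' (0, 1)
    have h2 := h0' (v, 0)
    simp only [lorentzForm_apply, map_zero] at h1 h2
    have hΛ := h.fun_nonneg x hx
    have hv : v = 0 := by
      by_contra hv
      have := h.pos x hx v hv
      have h4 : η x v = (Λ x + ε) * τ := by linarith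
      rw [h4] at h2
      nlinarith [mul_nonneg (add_nonneg hΛ hε) (sq_nonneg τ)]
    subst hv
    obtain ⟨z, hz⟩ : ∃ z, η x z ≠ 0 := by
      by_contra! hc
      exact h.form_ne_zero x hx (ContinuousLinearMap.ext hc)
    have h3 := h0' (z, 0)
    simp only [lorentzForm_apply, map_zero] at h3
    have : τ * η x z = 0 := by simpa using h3
    simp [(mul_eq_zero.1 this).resolve_right hz]
  have hdim : Module.finrank ℝ (E × ℝ) = Module.finrank ℝ ((E × ℝ) →L[ℝ] ℝ) := by
    rw [← (LinearMap.toContinuousLinearMap (𝕜 := ℝ) (E := E × ℝ) (F' := ℝ)).finrank_eq]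
    exact (Subspace.dual_finrank_eq (K := ℝ) (V := E × ℝ)).symm
  refine ⟨(LinearEquiv.ofInjectiveOfFinrankEq _ hinj hdim).toContinuousLinearEquiv, ?_⟩
  exact ContinuousLinearMap.ext fun v => rfl

theorem eq_rayAcc_iff (h : IsStationaryData U g η Λ) {x : E} (hx : x ∈ U) {ε : ℝ} (hε : 0 ≤ ε)
    (w : E) (A : E × ℝ) :
    (∀ z, lorentzForm g η Λ ε x A z + forceForm g η Λ x w z = 0) ↔ A = rayAcc g η Λ (x, w, ε) := by
  have hinv := lorentzForm_isInvertible h hx hε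
  have h1 : (∀ z, lorentzForm g η Λ ε x A z + forceForm g η Λ x w z = 0)
      ↔ lorentzForm g η Λ ε x A = -forceForm g η Λ x w := by
    rw [ContinuousLinearMap.ext_iff]
    simp only [neg_apply, ← add_eq_zero_iff_eq_neg]
  rw [h1, rayAcc, ← map_neg]
  constructor
  · intro h2
    rw [← h2, hinv.inverse_apply_self]
  · rintro rfl
    exact hinv.self_apply_inverse _

theorem lorentzForm_rayAcc (h : IsStationaryData U g η Λ) {x : E} (hx : x ∈ U) {ε : ℝ}
    (hε : 0 ≤ ε) (w : E) (z : E × ℝ) :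
    lorentzForm g η Λ ε x (rayAcc g η Λ (x, w, ε)) z + forceForm g η Λ x w z = 0 :=
  (eq_rayAcc_iff h hx hε w _).2 rfl z

theorem contDiffAt_rayAcc (h : IsStationaryData U g η Λ) {q : E × E × ℝ} (hx : q.1 ∈ U)
    (hε : 0 ≤ q.2.2) : ContDiffAt ℝ ∞ (rayAcc g η Λ) q := by
  have hG : ContDiffAt ℝ ∞ (fun q : E × E × ℝ => lorentzForm g η Λ q.2.2 q.1) q := by
    have := (contDiffOn_lorentzForm_prod h).contDiffAt (x := (q.1, q.2.2))
      ((h.isOpen.prod isOpen_univ).mem_nhds ⟨hx, mem_univ _⟩)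
    exact this.comp q (contDiffAt_fst.prodMk contDiffAt_snd.snd)
  have hinv : ContDiffAt ℝ ∞ (fun q : E × E × ℝ => (lorentzForm g η Λ q.2.2 q.1).inverse) q := by
    obtain ⟨e, he⟩ := lorentzForm_isInvertible h hx hε
    have := contDiffAt_map_inverse (𝕜 := ℝ) (n := ∞) e
    rw [he] at this
    exact this.comp q hG
  have hD : ∀ q : E × E × ℝ, q.1 ∈ U →
      ContDiffAt ℝ ∞ (fun q : E × E × ℝ => fderiv ℝ (lorentzForm g η Λ 0) q.1) q := by
    intro q hx
    have := ((contDiffOn_lorentzForm h 0).contDiffAt (h.isOpen.mem_nhds hx)).fderiv_right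
      (m := ∞) (by simp)
    exact this.comp q contDiffAt_fst
  have hF : ContDiffAt ℝ ∞ (fun q : E × E × ℝ => forceForm g η Λ q.1 q.2.1) q := by
    have := (contDiffOn_clm_apply (n := ∞)
      (f := fun q : E × E × ℝ => forceForm g η Λ q.1 q.2.1) (s := U ×ˢ univ)).2 fun z => ?_
    · exact this.contDiffAt ((h.isOpen.prod isOpen_univ).mem_nhds ⟨hx, mem_univ _⟩)
    · intro q hq
      simp only [forceForm_apply]
      have hD := hD q hq.1
      have hw : ContDiffAt ℝ ∞ (fun q : E × E × ℝ => q.2.1) q := contDiffAt_snd.fst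
      have hV : ContDiffAt ℝ ∞ (fun q : E × E × ℝ => (q.2.1, (1 : ℝ))) q :=
        hw.prodMk contDiffAt_const
      exact ((((hD.clm_apply hw).clm_apply hV).clm_apply contDiffAt_const).sub
        (contDiffAt_const.mul
          (((hD.clm_apply contDiffAt_const).clm_apply hV).clm_apply hV))).contDiffWithinAt
  exact (hinv.clm_apply hF).neg

theorem contDiffAt_rayField (h : IsStationaryData U g η Λ) {q : E × E × ℝ} (hx : q.1 ∈ U)
    (hε : 0 ≤ q.2.2) : ContDiffAt ℝ ∞ (rayField g η Λ) q := by
  have hA := contDiffAt_rayAcc h hx hε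
  exact hA.fst.sub (hA.snd.smul contDiffAt_snd.fst)

/-- At `w = 0` the force term is the differential of `Λ / 2`. -/
theorem forceForm_zero (h : IsStationaryData U g η Λ) {x : E} (hx : x ∈ U) :
    forceForm g η Λ x 0
      = (1 / 2 : ℝ) • (fderiv ℝ Λ x).comp (ContinuousLinearMap.fst ℝ E ℝ) := by
  refine ContinuousLinearMap.ext fun z => ?_
  rw [forceForm_apply, ← fderiv_lorentzForm_apply h hx 0 z.1]
  have e : (fun y => lorentzForm g η Λ 0 y ((0 : E), (1 : ℝ)) ((0 : E), (1 : ℝ)))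
      = fun y => -Λ y := by
    ext y; simp [lorentzForm_apply]
  rw [e, fderiv_fun_neg]
  simp

/-- The time component of the force term is minus the derivative of the energy `Λ - η(w)`
along `w`. -/
theorem forceForm_apply_time (h : IsStationaryData U g η Λ) {x : E} (hx : x ∈ U) (w : E) :
    forceForm g η Λ x w (0, 1) = fderiv ℝ η x w w - fderiv ℝ Λ x w := by
  rw [forceForm_apply, ← fderiv_lorentzForm_apply h hx 0]
  have e : (fun y => lorentzForm g η Λ 0 y (w, (1 : ℝ)) ((0 : E), (1 : ℝ)))
      = fun y => η y w - Λ y := by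
    ext y; simp [lorentzForm_apply]
  have h1 : HasFDerivAt η (fderiv ℝ η x) x :=
    ((h.contDiffOn_form.contDiffAt (h.isOpen.mem_nhds hx)).differentiableAt
      (by simp)).hasFDerivAt
  have h2 : HasFDerivAt Λ (fderiv ℝ Λ x) x :=
    ((h.contDiffOn_fun.contDiffAt (h.isOpen.mem_nhds hx)).differentiableAt
      (by simp)).hasFDerivAt
  rw [e, ((h1.clm_apply (hasFDerivAt_const w x)).fun_sub h2).fderiv]
  simp

end RayEquation

/-! ### Light rays in coordinates cannot be short loops -/

section ShortLoops

variable {E : Type*} [NormedAddCommGroup E] [NormedSpace ℝ E]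

/-- A nonnegative smooth function locally controls its gradient: `‖Df‖ ≤ C √f`. -/
theorem exists_norm_fderiv_le_mul_sqrt [FiniteDimensional ℝ E] {f : E → ℝ} {U : Set E}
    (hU : IsOpen U) (hf : ContDiffOn ℝ ∞ f U) (h0 : ∀ x ∈ U, 0 ≤ f x) {y : E} {r R : ℝ}
    (hrR : r < R) (hR : Metric.closedBall y R ⊆ U) :
    ∃ C, 0 ≤ C ∧ ∀ x ∈ Metric.closedBall y r, ‖fderiv ℝ f x‖ ≤ C * √(f x) := by
  have : ProperSpace E := FiniteDimensional.proper_real E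
  have hsub : Metric.closedBall y r ⊆ Metric.closedBall y R :=
    Metric.closedBall_subset_closedBall hrR.le
  have hD : ContDiffOn ℝ 1 (fderiv ℝ f) (Metric.closedBall y R) := fun x hx =>
    (((hf.contDiffAt (hU.mem_nhds (hR hx))).fderiv_right (m := ∞) (by simp)).of_le
      (by exact_mod_cast le_top)).contDiffWithinAt
  obtain ⟨L, hL⟩ := hD.exists_lipschitzOnWith one_ne_zero (convex_closedBall y R)
    (isCompact_closedBall y R)
  obtain ⟨B, hB⟩ := (isCompact_closedBall y r).exists_bound_of_continuousOn
    (hf.continuousOn.mono (hsub.trans hR))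
  set δ := R - r with hδ
  have hδ0 : 0 < δ := sub_pos.2 hrR
  have hfd : ∀ x ∈ U, HasFDerivAt f (fderiv ℝ f x) x := fun x hx =>
    ((hf.contDiffAt (hU.mem_nhds hx)).differentiableAt (by simp)).hasFDerivAt
  -- the first-order Taylor expansion, and the nonnegativity of `f` at its end point
  have taylor : ∀ x ∈ Metric.closedBall y r, ∀ v : E, ‖v‖ ≤ δ →
      -fderiv ℝ f x v ≤ f x + L * ‖v‖ ^ 2 := by
    intro x hx v hv
    have hxv : x + v ∈ Metric.closedBall y R := by
      rw [Metric.mem_closedBall, dist_eq_norm] at hx ⊢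
      calc ‖x + v - y‖ = ‖(x - y) + v‖ := by congr 1; abel
        _ ≤ ‖x - y‖ + ‖v‖ := norm_add_le _ _
        _ ≤ R := by linarith
    have hseg : segment ℝ x (x + v) ⊆ Metric.closedBall y R :=
      (convex_closedBall y R).segment_subset (hsub hx) hxv
    have h1 := (convex_segment x (x + v)).norm_image_sub_le_of_norm_hasFDerivWithin_le'
      (f := f) (φ := fderiv ℝ f x) (C := L * ‖v‖)
      (fun z hz => (hfd z (hR (hseg hz))).hasFDerivWithinAt)
      (fun z hz => by
        have h2 := hL.dist_le_mul _ (hseg hz) _ (hsub hx)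
        rw [dist_eq_norm] at h2
        refine h2.trans (mul_le_mul_of_nonneg_left ?_ L.2)
        have := norm_sub_le_of_mem_segment hz
        rw [dist_eq_norm]
        simpa [norm_sub_rev] using this)
      (left_mem_segment ℝ _ _) (right_mem_segment ℝ _ _)
    rw [add_sub_cancel_left, Real.norm_eq_abs] at h1
    have h3 := (abs_le.1 h1).2
    have h4 := h0 _ (hR hxv)
    nlinarith
  have hop : ∀ x ∈ Metric.closedBall y r, ∀ s, 0 < s → s ≤ δ →
      ‖fderiv ℝ f x‖ ≤ f x / s + L * s := by
    intro x hx s hs hsδ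
    have hfx := h0 x (hR (hsub hx))
    refine ContinuousLinearMap.opNorm_le_bound _ (by positivity) fun u => ?_
    rcases eq_or_ne u 0 with rfl | hu
    · simp
    have hu' : 0 < ‖u‖ := norm_pos_iff.2 hu
    have hn : ‖(s / ‖u‖) • u‖ = s := by
      rw [norm_smul, Real.norm_eq_abs, abs_of_pos (by positivity)]; field_simp
    have h1 := taylor x hx ((s / ‖u‖) • u) (by rw [hn]; exact hsδ)
    have h2 := taylor x hx (-((s / ‖u‖) • u)) (by rw [norm_neg, hn]; exact hsδ)
    rw [map_neg, norm_neg, hn] at h2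
    rw [hn] at h1
    rw [map_smul, smul_eq_mul] at h1 h2
    have h3 : s / ‖u‖ * |fderiv ℝ f x u| ≤ f x + L * s ^ 2 := by
      rw [← abs_of_pos (show 0 < s / ‖u‖ by positivity), ← abs_mul, abs_le]
      constructor <;> linarith
    rw [Real.norm_eq_abs]
    calc |fderiv ℝ f x u| = (s / ‖u‖ * |fderiv ℝ f x u|) * (‖u‖ / s) := by field_simp
      _ ≤ (f x + L * s ^ 2) * (‖u‖ / s) := by gcongr
      _ = _ := by field_simp
  set Q := √(|B| + 1) with hQ
  have hQ0 : 0 < Q := by positivity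
  refine ⟨Q / δ + L * (δ / Q), by positivity, fun x hx => ?_⟩
  rcases (h0 x (hR (hsub hx))).eq_or_lt with h | h
  · rw [← h, Real.sqrt_zero, mul_zero]
    refine le_of_tendsto_of_tendsto (b := 𝓝[>] (0 : ℝ)) tendsto_const_nhds
      (f := fun _ => ‖fderiv ℝ f x‖) (g := fun s => L * s) ?_ ?_
    · have : Tendsto (fun s : ℝ => (L : ℝ) * s) (𝓝 0) (𝓝 (L * 0)) :=
        tendsto_const_nhds.mul tendsto_id
      rw [mul_zero] at this
      exact this.mono_left nhdsWithin_le_nhds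
    · filter_upwards [Ioc_mem_nhdsGT hδ0] with s hs
      have := hop x hx s hs.1 hs.2
      rwa [← h, zero_div, zero_add] at this
  · -- the step length is chosen proportional to `√(f x)`
    set q := √(f x) with hq
    have hq0 : 0 < q := Real.sqrt_pos.2 h
    have hqq : f x = q ^ 2 := (Real.sq_sqrt h.le).symm
    have hqQ : q ≤ Q := Real.sqrt_le_sqrt (by
      have := (le_abs_self _).trans (hB x hx)
      linarith [le_abs_self B])
    have h1 := hop x hx (δ * (q / Q)) (by positivity)
      (mul_le_of_le_one_right hδ0.le ((div_le_one hQ0).2 hqQ))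
    rw [hqq] at h1
    refine h1.trans_eq ?_
    field_simp

variable {g : E → E →L[ℝ] E →L[ℝ] ℝ} {η : E → E →L[ℝ] ℝ} {Λ : E → ℝ} {U : Set E}

/-- Over a compact set, the metric `g` dominates a multiple of the norm. -/
theorem exists_pos_mul_norm_sq_le_metric [FiniteDimensional ℝ E] (h : IsStationaryData U g η Λ)
    {K : Set E} (hK : IsCompact K) (hKU : K ⊆ U) :
    ∃ m, 0 < m ∧ ∀ x ∈ K, ∀ v, m * ‖v‖ ^ 2 ≤ g x v v := by
  have : ProperSpace E := FiniteDimensional.proper_real E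
  have hc : ContinuousOn (fun q : E × E => g q.1 q.2 q.2) (K ×ˢ Metric.sphere 0 1) := by
    have h1 : ContinuousOn (fun q : E × E => g q.1) (K ×ˢ Metric.sphere 0 1) :=
      h.contDiffOn_metric.continuousOn.comp continuousOn_fst fun q hq => hKU hq.1
    exact (h1.clm_apply continuousOn_snd).clm_apply continuousOn_snd
  rcases (K ×ˢ Metric.sphere (0 : E) 1).eq_empty_or_nonempty with he | hne
  · refine ⟨1, one_pos, fun x hx v => ?_⟩
    rcases eq_or_ne v 0 with rfl | hv
    · simp
    · have : (x, ‖v‖⁻¹ • v) ∈ K ×ˢ Metric.sphere (0 : E) 1 := ⟨hx, by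
        rw [mem_sphere_zero_iff_norm, norm_smul, norm_inv, norm_norm,
          inv_mul_cancel₀ (norm_ne_zero_iff.2 hv)]⟩
      rw [he] at this
      exact this.elim
  · obtain ⟨⟨x₀, v₀⟩, hmem, hmin⟩ := (hK.prod (isCompact_sphere 0 1)).exists_isMinOn hne hc
    refine ⟨g x₀ v₀ v₀, h.pos x₀ (hKU hmem.1) v₀ ?_, fun x hx v => ?_⟩
    · rintro rfl
      simpa using mem_sphere_zero_iff_norm.1 hmem.2
    · rcases eq_or_ne v 0 with rfl | hv
      · simp
      have hv' : 0 < ‖v‖ := norm_pos_iff.2 hv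
      have h1 := hmin (show (x, ‖v‖⁻¹ • v) ∈ K ×ˢ Metric.sphere (0 : E) 1 from ⟨hx, by
        rw [mem_sphere_zero_iff_norm, norm_smul, norm_inv, norm_norm,
          inv_mul_cancel₀ hv'.ne']⟩)
      simp only [mem_ofPred_eq, map_smul, smul_apply, smul_eq_mul] at h1
      calc g x₀ v₀ v₀ * ‖v‖ ^ 2 ≤ (‖v‖⁻¹ * (‖v‖⁻¹ * g x v v)) * ‖v‖ ^ 2 := by gcongr
        _ = g x v v := by field_simp

/-- Over a compact set, the velocities of the light rays are bounded, uniformly in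
`ε ∈ [0, 1]`. -/
theorem exists_norm_velocity_le [FiniteDimensional ℝ E] (h : IsStationaryData U g η Λ)
    {K : Set E} (hK : IsCompact K) (hKU : K ⊆ U) :
    ∃ M, ∀ x ∈ K, ∀ ε ≤ (1 : ℝ), ∀ w, g x w w + 2 * η x w = Λ x + ε → ‖w‖ ≤ M := by
  obtain ⟨m, hm, hm'⟩ := exists_pos_mul_norm_sq_le_metric h hK hKU
  obtain ⟨A, hA⟩ := hK.exists_bound_of_continuousOn (h.contDiffOn_form.continuousOn.mono hKU)
  obtain ⟨B, hB⟩ := hK.exists_bound_of_continuousOn (h.contDiffOn_fun.continuousOn.mono hKU)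
  refine ⟨1 + (|B| + 1 + 2 * |A|) / m, fun x hx ε hε w hw => ?_⟩
  have h1 := hm' x hx w
  have h2 : |η x w| ≤ |A| * ‖w‖ :=
    ((η x).le_opNorm w).trans (by gcongr; exact (hA x hx).trans (le_abs_self A))
  have h3 : Λ x ≤ |B| := (le_abs_self _).trans ((hB x hx).trans (le_abs_self B))
  have h4 := (abs_le.1 h2).1
  rcases le_total ‖w‖ 1 with hw1 | hw1
  · have : 0 ≤ (|B| + 1 + 2 * |A|) / m := by positivity
    linarith
  · have h5 : m * ‖w‖ ≤ |B| + 1 + 2 * |A| := by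
      have : m * ‖w‖ * ‖w‖ ≤ (|B| + 1 + 2 * |A|) * ‖w‖ := by
        nlinarith [abs_nonneg B]
      exact le_of_mul_le_mul_right this (by linarith)
    have := (le_div_iff₀' hm).2 h5
    linarith

/-- The acceleration of a light ray is controlled by its velocity and by the differential of `Λ`;
the relative rate of change `-(rayAcc g η Λ (x, w, ε)).2` of its energy is bounded. -/
theorem exists_norm_rayField_le [FiniteDimensional ℝ E] (h : IsStationaryData U g η Λ)
    {K : Set E} (hK : IsCompact K) (hKc : Convex ℝ K) (hKU : K ⊆ U) (M : ℝ) :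
    ∃ C, 0 ≤ C ∧ ∀ x ∈ K, ∀ w, ‖w‖ ≤ M → ∀ ε ∈ Icc (0 : ℝ) 1,
      ‖rayField g η Λ (x, w, ε)‖ ≤ C * (‖fderiv ℝ Λ x‖ + ‖w‖) ∧
      |(rayAcc g η Λ (x, w, ε)).2| ≤ C := by
  have : ProperSpace E := FiniteDimensional.proper_real E
  set D : Set (E × E × ℝ) := K ×ˢ Metric.closedBall 0 M ×ˢ Icc 0 1 with hD
  have hDcpt : IsCompact D := hK.prod ((isCompact_closedBall 0 M).prod isCompact_Icc)
  have hDconv : Convex ℝ D := hKc.prod ((convex_closedBall 0 M).prod (convex_Icc 0 1))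
  have hf : ContDiffOn ℝ 1 (rayField g η Λ) D := fun q hq =>
    ((contDiffAt_rayField h (hKU hq.1) hq.2.2.1).of_le
      (by exact_mod_cast le_top)).contDiffWithinAt
  obtain ⟨L, hL⟩ := hf.exists_lipschitzOnWith one_ne_zero hDconv hDcpt
  obtain ⟨A, hA⟩ := hDcpt.exists_bound_of_continuousOn (f := rayAcc g η Λ)
    fun q hq => (contDiffAt_rayAcc h (hKU hq.1) hq.2.2.1).continuousAt.continuousWithinAt
  obtain ⟨N, hN⟩ := hDcpt.exists_bound_of_continuousOn
    (f := fun q => (lorentzForm g η Λ q.2.2 q.1).inverse) fun q hq => by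
      have h1 : ContinuousAt (fun q : E × E × ℝ => lorentzForm g η Λ q.2.2 q.1) q := by
        have := ((contDiffOn_lorentzForm_prod h).contDiffAt (x := (q.1, q.2.2))
          ((h.isOpen.prod isOpen_univ).mem_nhds ⟨hKU hq.1, mem_univ _⟩)).continuousAt
        exact this.comp (f := fun q : E × E × ℝ => (q.1, q.2.2)) (by fun_prop)
      have h2 := ((lorentzForm_isInvertible h (hKU hq.1) hq.2.2.1).contDiffAt_map_inverse
        (n := 0)).continuousAt
      exact (h2.comp (f := fun q : E × E × ℝ => lorentzForm g η Λ q.2.2 q.1)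
        h1).continuousWithinAt
  refine ⟨max |A| (max L |N|), by positivity, fun x hx w hw ε hε => ⟨?_, ?_⟩⟩
  · have hmem : (x, w, ε) ∈ D := ⟨hx, by simpa using hw, hε⟩
    have hmem0 : (x, 0, ε) ∈ D := ⟨hx, by simpa using (norm_nonneg w).trans hw, hε⟩
    have h1 := hL.dist_le_mul _ hmem _ hmem0
    have h2 : dist (x, w, ε) ((x, 0, ε) : E × E × ℝ) = ‖w‖ := by
      simp [Prod.dist_eq]
    rw [h2, dist_eq_norm] at h1
    have h3 : ‖rayField g η Λ (x, 0, ε)‖ ≤ |N| * ‖fderiv ℝ Λ x‖ := by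
      have e : rayField g η Λ (x, 0, ε) = (rayAcc g η Λ (x, 0, ε)).1 := by simp [rayField]
      rw [e]
      refine (norm_fst_le _).trans ?_
      rw [rayAcc, norm_neg, forceForm_zero h (hKU hx)]
      refine (ContinuousLinearMap.le_opNorm _ _).trans
        (mul_le_mul ((hN _ hmem0).trans (le_abs_self N)) ?_ (norm_nonneg _) (abs_nonneg _))
      refine ContinuousLinearMap.opNorm_le_bound _ (norm_nonneg _) fun z => ?_
      simp only [smul_apply, ContinuousLinearMap.comp_apply, ContinuousLinearMap.coe_fst',
        smul_eq_mul]
      rw [norm_mul]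
      have h4 : ‖fderiv ℝ Λ x z.1‖ ≤ ‖fderiv ℝ Λ x‖ * ‖z‖ :=
        ((fderiv ℝ Λ x).le_opNorm _).trans (by gcongr; exact norm_fst_le z)
      have h5 : ‖(1 / 2 : ℝ)‖ ≤ 1 := by norm_num
      nlinarith [norm_nonneg (fderiv ℝ Λ x z.1), norm_nonneg (1 / 2 : ℝ)]
    have h4 : ‖rayField g η Λ (x, w, ε)‖ ≤ |N| * ‖fderiv ℝ Λ x‖ + L * ‖w‖ := by
      have := norm_le_norm_add_norm_sub (rayField g η Λ (x, 0, ε)) (rayField g η Λ (x, w, ε))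
      rw [norm_sub_rev] at this
      linarith
    refine h4.trans ?_
    rw [mul_add]
    gcongr
    · exact (le_max_right _ _).trans (le_max_right _ _)
    · exact (le_max_left _ _).trans (le_max_right _ _)
  · have hmem : (x, w, ε) ∈ D := ⟨hx, by simpa using hw, hε⟩
    have := (norm_snd_le _).trans (hA _ hmem)
    rw [Real.norm_eq_abs] at this
    exact this.trans ((le_abs_self A).trans (le_max_left _ _))

variable (g η Λ) in
/-- The curve `x`, defined on `J`, solves the equation of the light rays of
`lorentzForm g η Λ ε` and is null; `w` is its velocity. -/
structure IsRayOn (ε : ℝ) (x w : ℝ → E) (J : Set ℝ) : Prop where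
  hasDeriv_pos : ∀ t ∈ J, HasDerivWithinAt x (w t) J t
  hasDeriv_vel : ∀ t ∈ J, HasDerivWithinAt w (rayField g η Λ (x t, w t, ε)) J t
  null : ∀ t ∈ J, g (x t) (w t) (w t) + 2 * η (x t) (w t) = Λ (x t) + ε

/-- The energy `Λ + ε - η(w)` of a light ray, for the vector field `∂ₜ`, solves a linear
differential equation: for an affine parameter it would be constant. -/
theorem IsRayOn.hasDerivWithinAt_energy [FiniteDimensional ℝ E] (h : IsStationaryData U g η Λ)
    {ε : ℝ} {x w : ℝ → E} {J : Set ℝ} (hr : IsRayOn g η Λ ε x w J) (hε : 0 ≤ ε) {t : ℝ}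
    (ht : t ∈ J) (hU : x t ∈ U) :
    HasDerivWithinAt (fun t => Λ (x t) + ε - η (x t) (w t))
      (-(rayAcc g η Λ (x t, w t, ε)).2 * (Λ (x t) + ε - η (x t) (w t))) J t := by
  have h1 : HasFDerivAt η (fderiv ℝ η (x t)) (x t) :=
    ((h.contDiffOn_form.contDiffAt (h.isOpen.mem_nhds hU)).differentiableAt
      (by simp)).hasFDerivAt
  have h2 : HasFDerivAt Λ (fderiv ℝ Λ (x t)) (x t) :=
    ((h.contDiffOn_fun.contDiffAt (h.isOpen.mem_nhds hU)).differentiableAt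
      (by simp)).hasFDerivAt
  have hx := hr.hasDeriv_pos t ht
  have hw := hr.hasDeriv_vel t ht
  have h3 := ((h2.comp_hasDerivWithinAt t hx).add_const ε).fun_sub
    ((h1.comp_hasDerivWithinAt t hx).clm_apply hw)
  refine h3.congr_deriv ?_
  have h4 := lorentzForm_rayAcc h hU hε (w t) (0, 1)
  rw [forceForm_apply_time h hU, lorentzForm_apply] at h4
  simp only [rayField, map_sub, map_smul, smul_eq_mul, map_zero, Function.comp_apply] at h4 ⊢
  linarith

set_option maxHeartbeats 400000 in
/-- A light ray that starts and ends over the same point cannot be arbitrarily short. With `M` the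
maximal energy, velocity and acceleration are `O(√M)`; a loop of duration `T` then has velocities
`O(√M T)`, whereas `g(w, w)` equals the energy minus `η(w)`, which is of order `M` at a time at
which the form `η`, frozen at the base point, vanishes on `w`. -/
theorem exists_pos_le_duration_of_loop [FiniteDimensional ℝ E] (h : IsStationaryData U g η Λ)
    {y : E} {R : ℝ} (hR0 : 0 < R) (hR : Metric.closedBall y R ⊆ U) :
    ∃ δ > 0, ∀ ε ∈ Ioc (0 : ℝ) 1, ∀ (x w : ℝ → E) (a b : ℝ), a < b →
      (∀ t ∈ Icc a b, x t ∈ Metric.closedBall y (R / 2)) → IsRayOn g η Λ ε x w (Icc a b) →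
      x a = y → x b = y → δ ≤ b - a := by
  have : ProperSpace E := FiniteDimensional.proper_real E
  set K := Metric.closedBall y (R / 2) with hK
  have hKcpt : IsCompact K := isCompact_closedBall _ _
  have hKc : Convex ℝ K := convex_closedBall _ _
  have hKU : K ⊆ U := (Metric.closedBall_subset_closedBall (by linarith)).trans hR
  have hyK : y ∈ K := Metric.mem_closedBall_self (by linarith)
  obtain ⟨m, hm, hgm⟩ := exists_pos_mul_norm_sq_le_metric h hKcpt hKU
  obtain ⟨V, hV⟩ := exists_norm_velocity_le h hKcpt hKU
  obtain ⟨C₁, hC₁, hfield⟩ := exists_norm_rayField_le h hKcpt hKc hKU V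
  obtain ⟨C₂, hC₂, hgrad⟩ := exists_norm_fderiv_le_mul_sqrt h.isOpen h.contDiffOn_fun
    h.fun_nonneg (show R / 2 < R by linarith) hR
  have hgn : ContinuousOn (fun x => ‖g x‖) K :=
    continuous_norm.comp_continuousOn (h.contDiffOn_metric.continuousOn.mono hKU)
  obtain ⟨G, hG⟩ := hKcpt.exists_bound_of_continuousOn hgn
  obtain ⟨L, hL⟩ := ((h.contDiffOn_form.mono hKU).of_le
    (show (1 : ℕ∞ω) ≤ (∞ : ℕ∞ω) by exact_mod_cast le_top)).exists_lipschitzOnWith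
      one_ne_zero hKc hKcpt
  set C₃ := √(2 / m) with hC₃
  have hC₃0 : 0 ≤ C₃ := Real.sqrt_nonneg _
  set C₄ := C₁ * (C₂ * √2 + C₃) with hC₄
  have hC₄0 : 0 ≤ C₄ := by positivity
  set C₅ := 4 * |G| * C₄ ^ 2 + L * C₃ ^ 2 with hC₅
  have hC₅0 : 0 ≤ C₅ := by positivity
  refine ⟨min 1 (min (1 / (2 * (C₁ + 1))) (1 / (4 * (C₅ + 1)))), by positivity, ?_⟩
  intro ε hε x w a b hab hxK hr hxa hxb
  by_contra! hT
  set T := b - a with hT'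
  have hT0 : 0 < T := sub_pos.2 hab
  obtain ⟨hT1, hT23⟩ := lt_min_iff.1 hT
  obtain ⟨hT2, hT3⟩ := lt_min_iff.1 hT23
  rw [lt_div_iff₀ (by positivity)] at hT2 hT3
  have hconv : Convex ℝ (Icc a b) := convex_Icc a b
  have ha : a ∈ Icc a b := left_mem_Icc.2 hab.le
  have hb : b ∈ Icc a b := right_mem_Icc.2 hab.le
  have hdist : ∀ t ∈ Icc a b, ∀ s ∈ Icc a b, |t - s| ≤ T := fun t ht s hs =>
    abs_le.2 ⟨by linarith [ht.1, hs.2], by linarith [ht.2, hs.1]⟩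
  -- the energy and its maximum
  set c : ℝ → ℝ := fun t => Λ (x t) + ε - η (x t) (w t) with hc
  have hcd : ∀ t ∈ Icc a b,
      HasDerivWithinAt c (-(rayAcc g η Λ (x t, w t, ε)).2 * c t) (Icc a b) t :=
    fun t ht => hr.hasDerivWithinAt_energy h hε.1.le ht (hKU (hxK t ht))
  have hwV : ∀ t ∈ Icc a b, ‖w t‖ ≤ V := fun t ht =>
    hV _ (hxK t ht) ε hε.2 _ (hr.null t ht)
  have hgc : ∀ t ∈ Icc a b, g (x t) (w t) (w t) = 2 * c t - (Λ (x t) + ε) := fun t ht => by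
    have := hr.null t ht
    simp only [hc]; linarith
  have hg0 : ∀ t ∈ Icc a b, 0 ≤ g (x t) (w t) (w t) := fun t ht =>
    (by positivity : 0 ≤ m * ‖w t‖ ^ 2).trans (hgm _ (hxK t ht) _)
  have hΛ0 : ∀ t ∈ Icc a b, 0 ≤ Λ (x t) := fun t ht => h.fun_nonneg _ (hKU (hxK t ht))
  have hcpos : ∀ t ∈ Icc a b, 0 < c t := fun t ht => by
    have h1 := hgc t ht
    have h2 := hg0 t ht
    have h3 := hΛ0 t ht
    linarith [hε.1]
  obtain ⟨tm, htm, hmax⟩ := isCompact_Icc.exists_isMaxOn ⟨a, ha⟩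
    (fun t ht => (hcd t ht).continuousWithinAt : ContinuousOn c (Icc a b))
  set M := c tm with hM
  have hM0 : 0 < M := hcpos tm htm
  have hcM : ∀ t ∈ Icc a b, c t ≤ M := fun t ht => hmax ht
  -- the energy stays comparable to its maximum during a short time
  have hcM' : ∀ t ∈ Icc a b, M / 2 ≤ c t := fun t ht => by
    have h1 := hconv.norm_image_sub_le_of_norm_hasDerivWithin_le (C := C₁ * M) hcd
      (fun s hs => by
        rw [norm_mul, norm_neg, Real.norm_eq_abs, Real.norm_eq_abs, abs_of_pos (hcpos s hs)]
        exact mul_le_mul (hfield _ (hxK s hs) _ (hwV s hs) ε ⟨hε.1.le, hε.2⟩).2 (hcM s hs)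
          (hcpos s hs).le hC₁) ht htm
    rw [Real.norm_eq_abs, Real.norm_eq_abs] at h1
    have h2 := (le_abs_self _).trans h1
    have h3 : C₁ * M * |tm - t| ≤ C₁ * M * T := by gcongr; exact hdist _ htm _ ht
    have h4 : C₁ * T ≤ 1 / 2 := by
      have : T * (2 * (C₁ + 1)) = 2 * (C₁ * T) + 2 * T := by ring
      linarith
    have h5 := mul_le_mul_of_nonneg_right h4 hM0.le
    have h6 : C₁ * M * T = C₁ * T * M := by ring
    linarith
  -- velocities and accelerations are `O(√M)`, since `g(w, w)` and `Λ` are `O(M)`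
  set β := √M with hβ
  have hβ2 : β ^ 2 = M := Real.sq_sqrt hM0.le
  have hβ0 : 0 < β := Real.sqrt_pos.2 hM0
  have hwβ : ∀ t ∈ Icc a b, ‖w t‖ ≤ C₃ * β := fun t ht => by
    rw [hC₃, hβ, ← Real.sqrt_mul (by positivity)]
    refine Real.le_sqrt_of_sq_le ?_
    have h1 := hgm _ (hxK t ht) (w t)
    have h2 := hgc t ht
    have h3 := hcM t ht
    have h4 := hΛ0 t ht
    rw [div_mul_eq_mul_div, le_div_iff₀' hm]
    linarith [hε.1]
  have hfβ : ∀ t ∈ Icc a b, ‖rayField g η Λ (x t, w t, ε)‖ ≤ C₄ * β := fun t ht => by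
    refine ((hfield _ (hxK t ht) _ (hwV t ht) ε ⟨hε.1.le, hε.2⟩).1).trans ?_
    have h1 : √(Λ (x t)) ≤ √2 * β := by
      rw [hβ, ← Real.sqrt_mul (by norm_num)]
      refine Real.sqrt_le_sqrt ?_
      have h2 := hgc t ht
      have h3 := hcM t ht
      have h4 := hg0 t ht
      linarith [hε.1]
    have h2 : ‖fderiv ℝ Λ (x t)‖ ≤ C₂ * (√2 * β) :=
      (hgrad _ (hxK t ht)).trans (by gcongr)
    have h3 := hwβ t ht
    calc _ ≤ C₁ * (C₂ * (√2 * β) + C₃ * β) := by gcongr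
      _ = C₄ * β := by rw [hC₄]; ring
  have hlipw : ∀ t ∈ Icc a b, ‖w t - w a‖ ≤ C₄ * β * |t - a| := fun t ht => by
    simpa using hconv.norm_image_sub_le_of_norm_hasDerivWithin_le hr.hasDeriv_vel hfβ ha ht
  -- the displacement of a loop vanishes, which bounds its velocity
  have hwa : ‖w a‖ ≤ C₄ * β * T := by
    have h1 := norm_sub_sub_smul_le_of_hasDerivWithinAt hconv hr.hasDeriv_pos ha hlipw hb
    rw [hxa, hxb, sub_self, zero_sub, norm_neg, norm_smul, Real.norm_eq_abs, ← hT',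
      abs_of_pos hT0] at h1
    refine le_of_mul_le_mul_left (h1.trans_eq ?_) hT0
    ring
  have hwT : ∀ t ∈ Icc a b, ‖w t‖ ≤ 2 * C₄ * β * T := fun t ht => by
    have h1 := norm_le_norm_add_norm_sub (w a) (w t)
    rw [norm_sub_rev] at h1
    have h2 : C₄ * β * |t - a| ≤ C₄ * β * T := by gcongr; exact hdist _ ht _ ha
    linarith [hlipw t ht]
  have hxT : ∀ t ∈ Icc a b, ‖x t - y‖ ≤ C₃ * β * T := fun t ht => by
    have h1 := hconv.norm_image_sub_le_of_norm_hasDerivWithin_le hr.hasDeriv_pos hwβ ha ht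
    rw [hxa] at h1
    refine h1.trans ?_
    rw [Real.norm_eq_abs]
    gcongr
    exact hdist _ ht _ ha
  have hnhds : ∀ t ∈ Ioo a b, Icc a b ∈ 𝓝 t := fun t ht => Icc_mem_nhds ht.1 ht.2
  -- by Rolle's theorem the form `η y` vanishes on the velocity at some time; there the energy is
  -- `g(w, w)` up to a small error
  obtain ⟨t, ht, hzero⟩ : ∃ t ∈ Ioo a b, η y (w t) = 0 :=
    exists_hasDerivAt_eq_zero (f := fun t => η y (x t)) hab
      (fun t ht => ((η y).continuous.continuousAt.comp_continuousWithinAt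
        (hr.hasDeriv_pos t ht).continuousWithinAt))
      (by simp only [hxa, hxb])
      (fun t ht => (η y).hasFDerivAt.comp_hasDerivAt t
        ((hr.hasDeriv_pos t (Ioo_subset_Icc_self ht)).hasDerivAt (hnhds t ht)))
  have ht' := Ioo_subset_Icc_self ht
  have hη : |η (x t) (w t)| ≤ L * C₃ ^ 2 * M * T := by
    have h1 : η (x t) (w t) = (η (x t) - η y) (w t) := by simp [hzero]
    have h2 := hL.dist_le_mul _ (hxK t ht') _ hyK
    rw [dist_eq_norm, dist_eq_norm] at h2
    rw [h1, ← Real.norm_eq_abs]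
    calc ‖(η (x t) - η y) (w t)‖ ≤ ‖η (x t) - η y‖ * ‖w t‖ := ContinuousLinearMap.le_opNorm _ _
      _ ≤ (L * (C₃ * β * T)) * (C₃ * β) := by
        gcongr
        · exact h2.trans (mul_le_mul_of_nonneg_left (hxT t ht') L.2)
        · exact hwβ t ht'
      _ = L * C₃ ^ 2 * β ^ 2 * T := by ring
      _ = _ := by rw [hβ2]
  have hgw : g (x t) (w t) (w t) ≤ 4 * |G| * C₄ ^ 2 * M * T ^ 2 := by
    calc g (x t) (w t) (w t) ≤ ‖g (x t) (w t) (w t)‖ := le_abs_self _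
      _ ≤ ‖g (x t)‖ * ‖w t‖ * ‖w t‖ := ContinuousLinearMap.le_opNorm₂ _ _ _
      _ ≤ |G| * (2 * C₄ * β * T) * (2 * C₄ * β * T) := by
        gcongr
        · exact ((le_abs_self _).trans (hG _ (hxK t ht'))).trans (le_abs_self G)
        · exact hwT t ht'
        · exact hwT t ht'
      _ = 4 * |G| * C₄ ^ 2 * β ^ 2 * T ^ 2 := by ring
      _ = _ := by rw [hβ2]
  have h1 : c t = g (x t) (w t) (w t) + η (x t) (w t) := by
    have := hr.null t ht'
    simp only [hc]; linarith
  have h2 := hcM' t ht'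
  have h3 : M / 2 ≤ C₅ * T * M := by
    have h4 : 4 * |G| * C₄ ^ 2 * M * T ^ 2 ≤ 4 * |G| * C₄ ^ 2 * M * T := by
      gcongr
      exact pow_le_of_le_one hT0.le hT1.le two_ne_zero
    have h5 := (le_abs_self _).trans hη
    calc M / 2 ≤ 4 * |G| * C₄ ^ 2 * M * T + L * C₃ ^ 2 * M * T := by linarith
      _ = C₅ * T * M := by rw [hC₅]; ring
  have h4 : 1 / 2 ≤ C₅ * T := by
    refine le_of_mul_le_mul_right ?_ hM0
    linarith
  have h5 : T * (4 * (C₅ + 1)) = 4 * (C₅ * T) + 4 * T := by ring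
  linarith

end ShortLoops

/-! ### Coordinate expressions of the geometric objects -/

section Charts

variable {E : Type*} [NormedAddCommGroup E] [NormedSpace ℝ E]
  {S : Type*} [TopologicalSpace S] [ChartedSpace E S]

variable (E) in
/-- The differential `E → T S` of the inverse of the chart at `p`. -/
def chartFrame (p : S) (x : E) :
    E →L[ℝ] TangentSpace 𝓘(ℝ, E) ((extChartAt 𝓘(ℝ, E) p).symm x) :=
  mfderiv 𝓘(ℝ, E) 𝓘(ℝ, E) (extChartAt 𝓘(ℝ, E) p).symm x

/-- The one-form `η` in the chart at `p`. -/
def chartForm (η : ∀ x : S, TangentSpace 𝓘(ℝ, E) x →L[ℝ] ℝ) (p : S) (x : E) : E →L[ℝ] ℝ :=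
  (η ((extChartAt 𝓘(ℝ, E) p).symm x)).comp (chartFrame E p x)

/-- The function `Λ` in the chart at `p`. -/
def chartFun (Λ : S → ℝ) (p : S) (x : E) : ℝ :=
  Λ ((extChartAt 𝓘(ℝ, E) p).symm x)

theorem spacePart_apply (q : S × ℝ) (v : TangentSpace (𝓘(ℝ, E).prod 𝓘(ℝ, ℝ)) q) :
    spacePart E q v = (v : E × ℝ).1 := by
  rw [spacePart, mfderiv_fst]; rfl

theorem timeForm_apply (q : S × ℝ) (v : TangentSpace (𝓘(ℝ, E).prod 𝓘(ℝ, ℝ)) q) :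
    timeForm E q v = (v : E × ℝ).2 := by
  rw [timeForm, mfderiv_snd]; rfl

section

variable [IsManifold 𝓘(ℝ, E) ∞ S]

theorem contMDiffOn_chartFrame (p : S) (v : E) :
    ContMDiffOn 𝓘(ℝ, E) (𝓘(ℝ, E).prod 𝓘(ℝ, E)) ∞
      (fun x => TotalSpace.mk' E (E := fun x : S => TangentSpace 𝓘(ℝ, E) x)
        ((extChartAt 𝓘(ℝ, E) p).symm x) (chartFrame E p x v)) (extChartAt 𝓘(ℝ, E) p).target := by
  have hopen : IsOpen (extChartAt 𝓘(ℝ, E) p).target := isOpen_extChartAt_target p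
  have h1 : ContMDiffOn 𝓘(ℝ, E) 𝓘(ℝ, E) ∞ (extChartAt 𝓘(ℝ, E) p).symm
    (extChartAt 𝓘(ℝ, E) p).target := contMDiffOn_extChartAt_symm p
  have h2 := h1.contMDiffOn_tangentMapWithin (m := ∞) (by simp) hopen.uniqueMDiffOn
  have h3 : ContMDiff 𝓘(ℝ, E) 𝓘(ℝ, E).tangent ∞
      (fun x : E => (⟨x, v⟩ : TangentBundle 𝓘(ℝ, E) E)) :=
    contMDiff_vectorSpace_iff_contDiff.2 contDiff_const
  refine (h2.comp h3.contMDiffOn (fun x hx => hx)).congr fun x hx => ?_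
  simp only [Function.comp_apply, tangentMapWithin, chartFrame]
  rw [mfderivWithin_of_isOpen hopen hx]
  rfl

theorem isInvertible_chartFrame (p : S) {x : E} (hx : x ∈ (extChartAt 𝓘(ℝ, E) p).target) :
    (chartFrame E p x).IsInvertible := by
  have : IsManifold 𝓘(ℝ, E) 1 S := IsManifold.of_le (n := ∞) (by exact_mod_cast le_top)
  have h := isInvertible_mfderivWithin_extChartAt_symm (I := 𝓘(ℝ, E)) hx
  rw [modelWithCornersSelf_coe, range_id, mfderivWithin_univ] at h
  exact h

theorem mfderiv_extChartAt_prod_symm_apply (P : S × ℝ) {X : E × ℝ}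
    (hX : X.1 ∈ (extChartAt 𝓘(ℝ, E) P.1).target) (V : E × ℝ) :
    mfderiv 𝓘(ℝ, E × ℝ) (𝓘(ℝ, E).prod 𝓘(ℝ, ℝ))
      (extChartAt (𝓘(ℝ, E).prod 𝓘(ℝ, ℝ)) P).symm X V = (chartFrame E P.1 X.1 V.1, V.2) := by
  have hopen : IsOpen (extChartAt 𝓘(ℝ, E) P.1).target := isOpen_extChartAt_target P.1
  have h1 : HasMFDerivAt 𝓘(ℝ, E) 𝓘(ℝ, E) (extChartAt 𝓘(ℝ, E) P.1).symm X.1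
      (chartFrame E P.1 X.1) :=
    (((contMDiffOn_extChartAt_symm (I := 𝓘(ℝ, E)) (n := ∞) P.1).contMDiffAt
      (hopen.mem_nhds hX)).mdifferentiableAt (by simp)).hasMFDerivAt
  have h2 : HasMFDerivAt 𝓘(ℝ, E × ℝ) 𝓘(ℝ, E) (Prod.fst : E × ℝ → E) X
      (ContinuousLinearMap.fst ℝ E ℝ) := hasFDerivAt_fst.hasMFDerivAt
  have h3 : HasMFDerivAt 𝓘(ℝ, E × ℝ) 𝓘(ℝ, ℝ) (Prod.snd : E × ℝ → ℝ) X
      (ContinuousLinearMap.snd ℝ E ℝ) := hasFDerivAt_snd.hasMFDerivAt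
  have h4 := (HasMFDerivAt.comp X h1 h2).prodMk h3
  have h5 : HasMFDerivAt 𝓘(ℝ, E × ℝ) (𝓘(ℝ, E).prod 𝓘(ℝ, ℝ))
    (extChartAt (𝓘(ℝ, E).prod 𝓘(ℝ, ℝ)) P).symm X _ := h4
  rw [h5.mfderiv]
  rfl

end

variable [RiemannianBundle (fun x : S => TangentSpace 𝓘(ℝ, E) x)]

variable (E) in
/-- The Riemannian metric in the chart at `p`. -/
def chartMetric (p : S) (x : E) : E →L[ℝ] E →L[ℝ] ℝ :=
  (innerSL ℝ (E := TangentSpace 𝓘(ℝ, E) ((extChartAt 𝓘(ℝ, E) p).symm x))).bilinearComp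
    (chartFrame E p x) (chartFrame E p x)

theorem chartMetric_apply (p : S) (x v w : E) :
    chartMetric E p x v w = inner ℝ (chartFrame E p x v) (chartFrame E p x w) := rfl

theorem isStationaryData_chart [IsManifold 𝓘(ℝ, E) ∞ S] [FiniteDimensional ℝ E]
    [IsContMDiffRiemannianBundle 𝓘(ℝ, E) ∞ E (fun x : S => TangentSpace 𝓘(ℝ, E) x)]
    {η : ∀ x : S, TangentSpace 𝓘(ℝ, E) x →L[ℝ] ℝ}
    (hη : ContMDiff 𝓘(ℝ, E) (𝓘(ℝ, E).prod 𝓘(ℝ, E →L[ℝ] ℝ)) ∞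
      (fun x => TotalSpace.mk' (E →L[ℝ] ℝ) (E := fun x : S => TangentSpace 𝓘(ℝ, E) x →L[ℝ] ℝ)
        x (η x)))
    (hη_ne : ∀ x, η x ≠ 0)
    {Λ : S → ℝ} (hΛ : ContMDiff 𝓘(ℝ, E) 𝓘(ℝ, ℝ) ∞ Λ) (hΛ_nonneg : ∀ x, 0 ≤ Λ x) (p : S) :
    IsStationaryData (extChartAt 𝓘(ℝ, E) p).target (chartMetric E p) (chartForm η p)
      (chartFun (E := E) Λ p) where
  isOpen := isOpen_extChartAt_target p
  contDiffOn_metric := contDiffOn_clm_apply.2 fun v => contDiffOn_clm_apply.2 fun w =>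
    contMDiffOn_iff_contDiffOn.1
      (ContMDiffOn.inner_bundle (E := fun x : S => TangentSpace 𝓘(ℝ, E) x)
        (contMDiffOn_chartFrame p v) (contMDiffOn_chartFrame p w))
  contDiffOn_form := contDiffOn_clm_apply.2 fun v => contMDiffOn_iff_contDiffOn.1 <| by
    have h1 := hη.comp_contMDiffOn (contMDiffOn_extChartAt_symm (I := 𝓘(ℝ, E)) (n := ∞) p)
    have h2 := ContMDiffOn.clm_bundle_apply (F₁ := E) (F₂ := ℝ)
      (E₁ := fun x : S => TangentSpace 𝓘(ℝ, E) x) (E₂ := Bundle.Trivial S ℝ)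
      (b := (extChartAt 𝓘(ℝ, E) p).symm) h1 (contMDiffOn_chartFrame p v)
    intro x hx
    have h3 := h2 x hx
    simp only [contMDiffWithinAt_totalSpace] at h3
    exact h3.2
  contDiffOn_fun := contMDiffOn_iff_contDiffOn.1
    (hΛ.comp_contMDiffOn (contMDiffOn_extChartAt_symm p))
  symm x _ v w := by rw [chartMetric_apply, chartMetric_apply, real_inner_comm]
  pos x hx v hv := by
    rw [chartMetric_apply]
    exact real_inner_self_pos.2 fun h =>
      hv ((isInvertible_chartFrame p hx).injective (h.trans (map_zero (chartFrame E p x)).symm))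
  form_ne_zero x hx h := by
    refine hη_ne ((extChartAt 𝓘(ℝ, E) p).symm x) (ContinuousLinearMap.ext fun v => ?_)
    obtain ⟨u, rfl⟩ := (isInvertible_chartFrame p hx).surjective v
    exact DFunLike.congr_fun h u
  fun_nonneg x _ := hΛ_nonneg _

theorem stationaryMetric_apply (η : ∀ x : S, TangentSpace 𝓘(ℝ, E) x →L[ℝ] ℝ) (Λ : S → ℝ) (ε : ℝ)
    (q : S × ℝ) (v w : TangentSpace (𝓘(ℝ, E).prod 𝓘(ℝ, ℝ)) q) :
    stationaryMetric η Λ ε q v w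
      = inner ℝ (spacePart E q v) (spacePart E q w) + η q.1 (spacePart E q v) * timeForm E q w
        + timeForm E q v * η q.1 (spacePart E q w)
        - (Λ q.1 + ε) * (timeForm E q v * timeForm E q w) := by
  simp only [stationaryMetric, LinearMap.sub_apply, LinearMap.add_apply, LinearMap.smul_apply,
    LinearMap.compl₁₂_apply, LinearMap.BilinForm.linMulLin_apply, LinearMap.comp_apply,
    innerₗ_apply_apply, smul_eq_mul]
  rfl

theorem metricInChart_stationaryMetric [IsManifold 𝓘(ℝ, E) ∞ S]
    (η : ∀ x : S, TangentSpace 𝓘(ℝ, E) x →L[ℝ] ℝ) (Λ : S → ℝ) (ε : ℝ) (P : S × ℝ) {X : E × ℝ}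
    (hX : X.1 ∈ (extChartAt 𝓘(ℝ, E) P.1).target) (V W : E × ℝ) :
    metricInChart (stationaryMetric η Λ ε) P X V W
      = lorentzForm (chartMetric E P.1) (chartForm η P.1) (chartFun Λ P.1) ε X.1 V W := by
  rw [metricInChart, stationaryMetric_apply, lorentzForm_apply]
  simp only [spacePart_apply, timeForm_apply]
  rw [mfderiv_extChartAt_prod_symm_apply P hX, mfderiv_extChartAt_prod_symm_apply P hX]
  rfl

theorem fderiv_metricInChart_stationaryMetric [FiniteDimensional ℝ E] [IsManifold 𝓘(ℝ, E) ∞ S]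
    {η : ∀ x : S, TangentSpace 𝓘(ℝ, E) x →L[ℝ] ℝ} {Λ : S → ℝ} (P : S × ℝ)
    (hd : IsStationaryData (extChartAt 𝓘(ℝ, E) P.1).target (chartMetric E P.1) (chartForm η P.1)
      (chartFun (E := E) Λ P.1)) (ε : ℝ) {X : E × ℝ}
    (hX : X.1 ∈ (extChartAt 𝓘(ℝ, E) P.1).target) (V W Z : E × ℝ) :
    fderiv ℝ (fun Y => metricInChart (stationaryMetric η Λ ε) P Y V W) X Z
      = fderiv ℝ (lorentzForm (chartMetric E P.1) (chartForm η P.1) (chartFun Λ P.1) 0) X.1 Z.1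
          V W := by
  have h1 : (fun Y => metricInChart (stationaryMetric η Λ ε) P Y V W) =ᶠ[𝓝 X]
      fun Y => lorentzForm (chartMetric E P.1) (chartForm η P.1) (chartFun Λ P.1) ε Y.1 V W := by
    have : ∀ᶠ Y : E × ℝ in 𝓝 X, Y.1 ∈ (extChartAt 𝓘(ℝ, E) P.1).target :=
      continuous_fst.continuousAt.eventually_mem (hd.isOpen.mem_nhds hX)
    filter_upwards [this] with Y hY
    exact metricInChart_stationaryMetric η Λ ε P hY V W
  have h2 : DifferentiableAt ℝ (fun y : E =>
      lorentzForm (chartMetric E P.1) (chartForm η P.1) (chartFun Λ P.1) ε y V W) X.1 :=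
    (((((contDiffOn_lorentzForm hd ε).contDiffAt (hd.isOpen.mem_nhds hX)).differentiableAt
      (by simp)).hasFDerivAt.clm_apply (hasFDerivAt_const V X.1)).clm_apply
        (hasFDerivAt_const W X.1)).differentiableAt
  have h3 := (h2.hasFDerivAt.comp X hasFDerivAt_fst).fderiv
  simp only [Function.comp_def] at h3
  rw [h1.fderiv_eq, ← fderiv_lorentzForm_apply hd hX ε, h3]
  rfl

theorem christoffelInChart_stationaryMetric [FiniteDimensional ℝ E] [IsManifold 𝓘(ℝ, E) ∞ S]
    {η : ∀ x : S, TangentSpace 𝓘(ℝ, E) x →L[ℝ] ℝ} {Λ : S → ℝ} (P : S × ℝ)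
    (hd : IsStationaryData (extChartAt 𝓘(ℝ, E) P.1).target (chartMetric E P.1) (chartForm η P.1)
      (chartFun (E := E) Λ P.1)) (ε : ℝ) {X : E × ℝ}
    (hX : X.1 ∈ (extChartAt 𝓘(ℝ, E) P.1).target) (c : ℝ) (w : E) (Z : E × ℝ) :
    christoffelInChart (stationaryMetric η Λ ε) P X (c • (w, (1 : ℝ))) (c • (w, (1 : ℝ))) Z
      = c ^ 2 * forceForm (chartMetric E P.1) (chartForm η P.1) (chartFun Λ P.1) X.1 w Z := by
  rw [christoffelInChart, fderiv_metricInChart_stationaryMetric P hd ε hX,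
    fderiv_metricInChart_stationaryMetric P hd ε hX, forceForm_apply]
  simp only [Prod.smul_fst, map_smul, smul_apply, smul_eq_mul]
  ring

end Charts

/-! ### Pregeodesics parametrized by `t` -/

section Pregeodesics

/-- First and second derivatives of the graph of `x` over a reparametrization `h`. -/
theorem derivWithin_graph_comp {F : Type*} [NormedAddCommGroup F] [NormedSpace ℝ F]
    {x w : ℝ → F} {α : F} {h h₁ : ℝ → ℝ} {h₂ s : ℝ} {I J : Set ℝ} (hI : UniqueDiffOn ℝ I)
    (hs : s ∈ I) (hm : MapsTo h I J)
    (hx : ∀ᶠ r in 𝓝[I] s, HasDerivWithinAt x (w (h r)) J (h r))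
    (hw : HasDerivWithinAt w α J (h s)) (hh : ∀ r ∈ I, HasDerivWithinAt h (h₁ r) I r)
    (hh₁ : HasDerivWithinAt h₁ h₂ I s) :
    derivWithin (fun r => (x (h r), h r)) I s = h₁ s • (w (h s), (1 : ℝ)) ∧
      derivWithin (derivWithin (fun r => (x (h r), h r)) I) I s
        = (h₂ • w (h s) + h₁ s ^ 2 • α, h₂) := by
  have h1 : derivWithin (fun r => (x (h r), h r)) I =ᶠ[𝓝[I] s]
      fun r => (h₁ r • w (h r), h₁ r) := by
    filter_upwards [hx, self_mem_nhdsWithin] with r hr hrI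
    exact ((hr.scomp r (hh r hrI) hm).prodMk (hh r hrI)).derivWithin (hI r hrI)
  have h2 := h1.eq_of_nhdsWithin hs
  refine ⟨by rw [h2]; simp, ?_⟩
  rw [h1.derivWithin_eq h2]
  have h3 := (hh₁.smul (hw.scomp s (hh s hs) hm)).prodMk hh₁
  refine HasDerivWithinAt.derivWithin ?_ (hI s hs)
  refine h3.congr_deriv ?_
  simp only [Function.comp_apply, smul_smul, pow_two]
  rw [add_comm]

theorem eventually_mem_chart_source {H S : Type*} [TopologicalSpace H] [TopologicalSpace S]
    [ChartedSpace H S] {σ : ℝ → S} {J : Set ℝ}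
    (hσ : ContinuousOn σ J) (p : S) {t : ℝ} (ht : t ∈ J)
    (hsrc : σ t ∈ (chartAt H p).source) : ∀ᶠ r in 𝓝[J] t, r ∈ J ∧ σ r ∈ (chartAt H p).source := by
  filter_upwards [self_mem_nhdsWithin,
    (hσ t ht).eventually_mem ((chartAt H p).open_source.mem_nhds hsrc)] with r h1 h2
  exact ⟨h1, h2⟩

variable {E : Type*} [NormedAddCommGroup E] [NormedSpace ℝ E]
  {S : Type*} [TopologicalSpace S] [ChartedSpace E S]

variable (E) in
/-- The coordinate expression of the curve `σ` in the chart at `p`. -/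
def chartCurve (p : S) (σ : ℝ → S) (t : ℝ) : E := extChartAt 𝓘(ℝ, E) p (σ t)

theorem contDiffWithinAt_chartCurve [IsManifold 𝓘(ℝ, E) ∞ S] {σ : ℝ → S} {J : Set ℝ}
    (hσ : ContMDiffOn 𝓘(ℝ, ℝ) 𝓘(ℝ, E) ∞ σ J) (p : S) {t : ℝ} (ht : t ∈ J)
    (hsrc : σ t ∈ (chartAt E p).source) : ContDiffWithinAt ℝ ∞ (chartCurve E p σ) J t := by
  refine contMDiffWithinAt_iff_contDiffWithinAt.1 ?_
  exact (contMDiffAt_extChartAt' (I := 𝓘(ℝ, E)) (n := ∞) hsrc).comp_contMDiffWithinAt t (hσ t ht)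

variable [RiemannianBundle (fun x : S => TangentSpace 𝓘(ℝ, E) x)]

/-- The right-hand side of the equation of the light rays in the chart at `p`. -/
def chartRayField (η : ∀ x : S, TangentSpace 𝓘(ℝ, E) x →L[ℝ] ℝ) (Λ : S → ℝ) (p : S) :
    E × E × ℝ → E :=
  rayField (chartMetric E p) (chartForm η p) (chartFun Λ p)

/-- The failure of `t` to be an affine parameter of a light ray, in the chart at `p`. -/
def chartRayRate (η : ∀ x : S, TangentSpace 𝓘(ℝ, E) x →L[ℝ] ℝ) (Λ : S → ℝ) (p : S)
    (q : E × E × ℝ) : ℝ :=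
  (rayAcc (chartMetric E p) (chartForm η p) (chartFun Λ p) q).2

/-- In every chart the curve `σ`, on `J`, solves the equation of the light rays of `g_ε`, and `κ`
is the failure of `t` to be an affine parameter: `h'' = κ(h) h'²` for an affine parametrization
`t = h(s)`. -/
def SolvesRayEquation (η : ∀ x : S, TangentSpace 𝓘(ℝ, E) x →L[ℝ] ℝ) (Λ : S → ℝ) (ε : ℝ)
    (σ : ℝ → S) (κ : ℝ → ℝ) (J : Set ℝ) : Prop :=
  ∀ p, ∀ t ∈ J, σ t ∈ (chartAt E p).source →
    HasDerivWithinAt (chartCurve E p σ) (derivWithin (chartCurve E p σ) J t) J t ∧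
    HasDerivWithinAt (derivWithin (chartCurve E p σ) J)
      (chartRayField η Λ p (chartCurve E p σ t, derivWithin (chartCurve E p σ) J t, ε)) J t ∧
    κ t = chartRayRate η Λ p (chartCurve E p σ t, derivWithin (chartCurve E p σ) J t, ε)

variable [FiniteDimensional ℝ E] [IsManifold 𝓘(ℝ, E) ∞ S]

/-- The geodesic equation of `g_ε` for the curve `(σ ∘ h, h)`, split into the equation of the light
rays for `σ` and the equation `h'' = κ(h) h'²` for `h`. -/
theorem geodesicEquation_iff {η : ∀ x : S, TangentSpace 𝓘(ℝ, E) x →L[ℝ] ℝ} {Λ : S → ℝ}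
    (P : S × ℝ)
    (hd : IsStationaryData (extChartAt 𝓘(ℝ, E) P.1).target (chartMetric E P.1) (chartForm η P.1)
      (chartFun (E := E) Λ P.1)) {ε : ℝ} (hε : 0 ≤ ε)
    {σ : ℝ → S} {w : ℝ → E} {α : E} {h h₁ : ℝ → ℝ} {κ s : ℝ} {I J : Set ℝ}
    (hI : UniqueDiffOn ℝ I) (hs : s ∈ I) (hm : MapsTo h I J)
    (hsrc : σ (h s) ∈ (chartAt E P.1).source)
    (hx : ∀ᶠ r in 𝓝[I] s, HasDerivWithinAt (chartCurve E P.1 σ) (w (h r)) J (h r))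
    (hw : HasDerivWithinAt w α J (h s)) (hh : ∀ r ∈ I, HasDerivWithinAt h (h₁ r) I r)
    (hh₁ : HasDerivWithinAt h₁ (κ * h₁ s ^ 2) I s) (hpos : 0 < h₁ s)
    {u : ℝ → E × ℝ}
    (hu : u = fun r => extChartAt (𝓘(ℝ, E).prod 𝓘(ℝ, ℝ)) P (σ (h r), h r)) :
    (∀ z : E × ℝ,
      metricInChart (stationaryMetric η Λ ε) P (u s) (derivWithin (derivWithin u I) I s) z
        + christoffelInChart (stationaryMetric η Λ ε) P (u s) (derivWithin u I s)
            (derivWithin u I s) z = 0) ↔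
      α = chartRayField η Λ P.1 (chartCurve E P.1 σ (h s), w (h s), ε) ∧
        κ = chartRayRate η Λ P.1 (chartCurve E P.1 σ (h s), w (h s), ε) := by
  have hu' : u = fun r => (chartCurve E P.1 σ (h r), h r) := hu
  obtain ⟨h1, h2⟩ := derivWithin_graph_comp hI hs hm hx hw hh hh₁
  rw [hu', h1, h2]
  set x := chartCurve E P.1 σ (h s) with hxdef
  have hX : x ∈ (extChartAt 𝓘(ℝ, E) P.1).target :=
    (extChartAt 𝓘(ℝ, E) P.1).map_source (by rwa [extChartAt_source])
  have hacc : ((κ * h₁ s ^ 2) • w (h s) + h₁ s ^ 2 • α, κ * h₁ s ^ 2)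
      = h₁ s ^ 2 • (α + κ • w (h s), κ) := by
    simp only [Prod.smul_mk, smul_add, smul_smul, smul_eq_mul, mul_comm κ]
    rw [add_comm]
  have key := eq_rayAcc_iff hd hX hε (w (h s)) (α + κ • w (h s), κ)
  rw [Prod.ext_iff] at key
  have e : (α = chartRayField η Λ P.1 (x, w (h s), ε) ∧ κ = chartRayRate η Λ P.1 (x, w (h s), ε))
      ↔ (α + κ • w (h s) = (rayAcc (chartMetric E P.1) (chartForm η P.1) (chartFun Λ P.1)
          (x, w (h s), ε)).1 ∧ κ = (rayAcc (chartMetric E P.1) (chartForm η P.1) (chartFun Λ P.1)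
          (x, w (h s), ε)).2) := by
    simp only [chartRayField, chartRayRate, rayField]
    constructor
    · rintro ⟨h3, h4⟩
      refine ⟨?_, h4⟩
      rw [h3, ← h4]; simp
    · rintro ⟨h3, h4⟩
      refine ⟨?_, h4⟩
      rw [← h3, ← h4]; simp
  rw [e, ← key]
  refine forall_congr' fun z => ?_
  rw [hacc, metricInChart_stationaryMetric η Λ ε P hX,
    christoffelInChart_stationaryMetric P hd ε hX, map_smul, smul_apply, smul_eq_mul, ← mul_add,
    mul_eq_zero]
  exact or_iff_right (by positivity)

/-- A pregeodesic of `g_ε` of the form `(σ(t), t)` solves the equation of the light rays. -/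
theorem IsPregeodesicOn.exists_solvesRayEquation
    {η : ∀ x : S, TangentSpace 𝓘(ℝ, E) x →L[ℝ] ℝ} {Λ : S → ℝ}
    (hd : ∀ p : S, IsStationaryData (extChartAt 𝓘(ℝ, E) p).target (chartMetric E p)
      (chartForm η p) (chartFun (E := E) Λ p)) {ε : ℝ} (hε : 0 ≤ ε) {σ : ℝ → S} {a b : ℝ}
    (hab : a < b) (hg : IsPregeodesicOn (stationaryMetric η Λ ε) (fun t => (σ t, t)) a b) :
    ∃ κ, SolvesRayEquation η Λ ε σ κ (Icc a b) := by
  obtain ⟨hγ, c, d, h, hcd, hc, hdb, hsm, hpos, -, hgeo⟩ := hg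
  have hσ : ContMDiffOn 𝓘(ℝ, ℝ) 𝓘(ℝ, E) ∞ σ (Icc a b) := contMDiff_fst.comp_contMDiffOn hγ
  have hI : UniqueDiffOn ℝ (Icc c d) := uniqueDiffOn_Icc hcd
  have hJ : UniqueDiffOn ℝ (Icc a b) := uniqueDiffOn_Icc hab
  have hh : ∀ r ∈ Icc c d, HasDerivWithinAt h (derivWithin h (Icc c d) r) (Icc c d) r :=
    fun r hr => ((hsm r hr).differentiableWithinAt (by simp)).hasDerivWithinAt
  have hmono : MonotoneOn h (Icc c d) := by
    refine monotoneOn_of_deriv_nonneg (convex_Icc c d) hsm.continuousOn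
      (fun r hr => ((hh r (interior_subset hr)).differentiableWithinAt).mono interior_subset)
      fun r hr => ?_
    have hr' := interior_subset hr
    rw [interior_Icc] at hr
    rw [((hh r hr').hasDerivAt (Icc_mem_nhds hr.1 hr.2)).deriv]
    exact (hpos r hr').le
  have hm : MapsTo h (Icc c d) (Icc a b) := fun r hr => by
    rw [← hc, ← hdb]
    exact ⟨hmono (left_mem_Icc.2 hcd.le) hr hr.1, hmono hr (right_mem_Icc.2 hcd.le) hr.2⟩
  have hsurj : ∀ t ∈ Icc a b, ∃ s ∈ Icc c d, h s = t := by
    rw [← hc, ← hdb]; exact intermediate_value_Icc hcd.le hsm.continuousOn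
  choose! k hk using hsurj
  -- `κ` is `h'' / h'²` at the preimage under `h`
  refine ⟨fun t => derivWithin (derivWithin h (Icc c d)) (Icc c d) (k t)
    / derivWithin h (Icc c d) (k t) ^ 2, fun p t ht hsrc => ?_⟩
  obtain ⟨hkt, hkt'⟩ := hk t ht
  have hx := contDiffWithinAt_chartCurve hσ p ht hsrc
  have hxd : ∀ᶠ r in 𝓝[Icc a b] t, HasDerivWithinAt (chartCurve E p σ)
      (derivWithin (chartCurve E p σ) (Icc a b) r) (Icc a b) r := by
    filter_upwards [eventually_mem_chart_source hσ.continuousOn p ht hsrc] with r hr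
    exact ((contDiffWithinAt_chartCurve hσ p hr.1 hr.2).differentiableWithinAt
      (by simp)).hasDerivWithinAt
  have hw : HasDerivWithinAt (derivWithin (chartCurve E p σ) (Icc a b))
      (derivWithin (derivWithin (chartCurve E p σ) (Icc a b)) (Icc a b) t) (Icc a b) t :=
    ((hx.derivWithin hJ (m := ∞) (by simp) ht).differentiableWithinAt
      (by simp)).hasDerivWithinAt
  have hh₁ := (((hsm _ hkt).derivWithin hI (m := ∞) (by simp) hkt).differentiableWithinAt
      (by simp)).hasDerivWithinAt
  have htend : Tendsto h (𝓝[Icc c d] (k t)) (𝓝[Icc a b] t) := by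
    have := (hsm.continuousOn _ hkt).tendsto_nhdsWithin hm
    rwa [hkt'] at this
  have hne : derivWithin h (Icc c d) (k t) ≠ 0 := (hpos _ hkt).ne'
  have hsrc' : σ (h (k t)) ∈ (chartAt E p).source := by rwa [hkt']
  -- the chart of `S × ℝ` at `(p, 0)` is the identity on the factor `ℝ`
  have hg0 := hgeo (p, 0) (k t) hkt ⟨hsrc', mem_univ _⟩
    (fun r => extChartAt (𝓘(ℝ, E).prod 𝓘(ℝ, ℝ)) (p, (0 : ℝ)) (σ (h r), h r)) rfl
  have key := (geodesicEquation_iff (p, (0 : ℝ)) (hd p) hε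
    (κ := derivWithin (derivWithin h (Icc c d)) (Icc c d) (k t)
      / derivWithin h (Icc c d) (k t) ^ 2) hI hkt hm hsrc'
    (htend.eventually hxd) (by rw [hkt']; exact hw) hh
    (hh₁.congr_deriv (by field_simp)) (hpos _ hkt) rfl).1 hg0
  simp only [hkt'] at key
  refine ⟨hxd.self_of_nhdsWithin ht, hw.congr_deriv key.1, ?_⟩
  exact key.2

/-- A solution of the equation of the light rays gives a pregeodesic `(σ(t), t)` of `g_ε`. -/
theorem SolvesRayEquation.isPregeodesicOn
    {η : ∀ x : S, TangentSpace 𝓘(ℝ, E) x →L[ℝ] ℝ} {Λ : S → ℝ}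
    (hd : ∀ p : S, IsStationaryData (extChartAt 𝓘(ℝ, E) p).target (chartMetric E p)
      (chartForm η p) (chartFun (E := E) Λ p)) {ε : ℝ} (hε : 0 ≤ ε) {σ : ℝ → S} {κ : ℝ → ℝ}
    {a b : ℝ} (hab : a < b) (hσ : ContinuousOn σ (Icc a b))
    (hs : SolvesRayEquation η Λ ε σ κ (Icc a b)) :
    IsPregeodesicOn (stationaryMetric η Λ ε) (fun t => (σ t, t)) a b := by
  have hJ : UniqueDiffOn ℝ (Icc a b) := uniqueDiffOn_Icc hab
  -- near each time, position and velocity in a chart solve a first-order equation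
  have hphase : ∀ t ∈ Icc a b, ∀ p, σ t ∈ (chartAt E p).source →
      ContDiffWithinAt ℝ ∞ (fun t => (chartCurve E p σ t,
        derivWithin (chartCurve E p σ) (Icc a b) t)) (Icc a b) t := by
    intro t ht p hsrc
    obtain ⟨V, hV, hVo, htV⟩ : ∃ V, (∀ r ∈ Icc a b ∩ V, σ r ∈ (chartAt E p).source) ∧
        IsOpen V ∧ t ∈ V := by
      obtain ⟨V, hVo, htV, hV⟩ := mem_nhdsWithin.1 (eventually_mem_chart_source hσ p ht hsrc)
      exact ⟨V, fun r hr => (hV ⟨hr.2, hr.1⟩).2, hVo, htV⟩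
    have h1 : ContDiffOn ℝ ∞ (fun t => (chartCurve E p σ t,
        derivWithin (chartCurve E p σ) (Icc a b) t)) (Icc a b ∩ V) := by
      refine contDiffOn_infty_of_hasDerivWithinAt_comp (hJ.inter hVo)
        (Φ := fun y : E × E => (y.2, chartRayField η Λ p (y.1, y.2, ε)))
        (O := (extChartAt 𝓘(ℝ, E) p).target ×ˢ univ) ?_ ?_ ?_
      · rintro ⟨x, w⟩ hxw
        have h2 := contDiffAt_rayField (hd p) (q := (x, w, ε)) hxw.1 hε
        exact (contDiffAt_snd.prodMk (h2.comp (x, w) (contDiffAt_fst.prodMk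
          (contDiffAt_snd.prodMk contDiffAt_const)))).contDiffWithinAt
      · exact fun r hr => ⟨(extChartAt 𝓘(ℝ, E) p).map_source
          (by rw [extChartAt_source]; exact hV r hr), mem_univ _⟩
      · intro r hr
        obtain ⟨h2, h3, -⟩ := hs p r hr.1 (hV r hr)
        exact (h2.prodMk h3).mono inter_subset_left
    exact (h1 t ⟨ht, htV⟩).mono_of_mem_nhdsWithin
      (inter_mem_nhdsWithin _ (hVo.mem_nhds htV))
  have hσs : ContMDiffOn 𝓘(ℝ, ℝ) 𝓘(ℝ, E) ∞ σ (Icc a b) := by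
    intro t ht
    have hsrc := mem_chart_source E (σ t)
    have h1 : ContMDiffWithinAt 𝓘(ℝ, ℝ) 𝓘(ℝ, E) ∞ (chartCurve E (σ t) σ) (Icc a b) t :=
      (hphase t ht (σ t) hsrc).fst.contMDiffWithinAt
    have htgt : chartCurve E (σ t) σ t ∈ (extChartAt 𝓘(ℝ, E) (σ t)).target :=
      mem_extChartAt_target (σ t)
    have h2 := ((contMDiffOn_extChartAt_symm (I := 𝓘(ℝ, E)) (n := ∞) (σ t)).contMDiffAt
      ((isOpen_extChartAt_target (I := 𝓘(ℝ, E)) (σ t)).mem_nhds htgt)).comp_contMDiffWithinAt t h1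
    refine h2.congr_of_eventuallyEq ?_ ?_
    · filter_upwards [eventually_mem_chart_source hσ (σ t) ht hsrc] with r hr
      exact ((extChartAt 𝓘(ℝ, E) (σ t)).left_inv (by rw [extChartAt_source]; exact hr.2)).symm
    · exact ((extChartAt 𝓘(ℝ, E) (σ t)).left_inv (by rw [extChartAt_source]; exact hsrc)).symm
  have hκ : ContDiffOn ℝ ∞ κ (Icc a b) := by
    intro t ht
    have hsrc := mem_chart_source E (σ t)
    have hmem : chartCurve E (σ t) σ t ∈ (extChartAt 𝓘(ℝ, E) (σ t)).target :=
      mem_extChartAt_target (σ t)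
    have h1 := hphase t ht (σ t) hsrc
    have h2 := (contDiffAt_rayAcc (hd (σ t)) (q := (chartCurve E (σ t) σ t,
      derivWithin (chartCurve E (σ t) σ) (Icc a b) t, ε)) hmem hε).snd.comp_contDiffWithinAt t
      (h1.fst.prodMk (h1.snd.prodMk contDiffWithinAt_const))
    refine h2.congr_of_eventuallyEq ?_ ?_
    · filter_upwards [eventually_mem_chart_source hσ (σ t) ht hsrc] with r hr
      exact (hs (σ t) r hr.1 hr.2).2.2
    · exact (hs (σ t) t ht hsrc).2.2
  have hγ : ContMDiffOn 𝓘(ℝ, ℝ) (𝓘(ℝ, E).prod 𝓘(ℝ, ℝ)) ∞ (fun t => (σ t, t)) (Icc a b) :=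
    hσs.prodMk contMDiffOn_id
  obtain ⟨d, h, hd0, h0, hdb, hsm, hm, hpos, h2⟩ := exists_reparametrization hab hκ
  have hI : UniqueDiffOn ℝ (Icc 0 d) := uniqueDiffOn_Icc hd0
  refine ⟨hγ, 0, d, h, hd0, h0, hdb, hsm, hpos, hγ.comp hsm.contMDiffOn hm, ?_⟩
  intro P s hsI hsrc u hu
  have hsrc' : σ (h s) ∈ (chartAt E P.1).source := hsrc.1
  have hh : ∀ r ∈ Icc 0 d, HasDerivWithinAt h (derivWithin h (Icc 0 d) r) (Icc 0 d) r :=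
    fun r hr => ((hsm r hr).differentiableWithinAt (by simp)).hasDerivWithinAt
  have hh₁ := (((hsm s hsI).derivWithin hI (m := ∞) (by simp) hsI).differentiableWithinAt
      (by simp)).hasDerivWithinAt
  have htend : Tendsto h (𝓝[Icc 0 d] s) (𝓝[Icc a b] (h s)) :=
    (hsm.continuousOn s hsI).tendsto_nhdsWithin hm
  have hxd : ∀ᶠ r in 𝓝[Icc a b] (h s), HasDerivWithinAt (chartCurve E P.1 σ)
      (derivWithin (chartCurve E P.1 σ) (Icc a b) r) (Icc a b) r := by
    filter_upwards [eventually_mem_chart_source hσ P.1 (hm hsI) hsrc'] with r hr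
    exact (hs P.1 r hr.1 hr.2).1
  exact (geodesicEquation_iff P (hd P.1) hε hI hsI hm hsrc' (htend.eventually hxd)
    (hs P.1 (h s) (hm hsI) hsrc').2.1 hh (hh₁.congr_deriv (h2 s hsI)) (hpos s hsI) hu).2
    ⟨rfl, (hs P.1 (h s) (hm hsI) hsrc').2.2⟩

end Pregeodesics

/-! ### Velocities of light rays -/

section Velocities

variable {E : Type*} [NormedAddCommGroup E] [NormedSpace ℝ E]

section Topological

variable {S : Type*} [TopologicalSpace S] [ChartedSpace E S]

theorem mfderivWithin_graph {σ : ℝ → S} {a b t : ℝ} (hab : a < b) (ht : t ∈ Icc a b)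
    (hσ : MDifferentiableWithinAt 𝓘(ℝ, ℝ) 𝓘(ℝ, E) σ (Icc a b) t) :
    mfderivWithin 𝓘(ℝ, ℝ) (𝓘(ℝ, E).prod 𝓘(ℝ, ℝ)) (fun t => (σ t, t)) (Icc a b) t
      = (mfderivWithin 𝓘(ℝ, ℝ) 𝓘(ℝ, E) σ (Icc a b) t).prod
          (ContinuousLinearMap.id ℝ (TangentSpace 𝓘(ℝ, ℝ) t)) :=
  (hσ.hasMFDerivWithinAt.prodMk (hasMFDerivWithinAt_id (Icc a b) t)).mfderivWithin
    ((uniqueDiffOn_Icc hab) t ht).uniqueMDiffWithinAt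

theorem spacePart_velocityOn {σ : ℝ → S} {a b t : ℝ} (hab : a < b) (ht : t ∈ Icc a b)
    (hσ : MDifferentiableWithinAt 𝓘(ℝ, ℝ) 𝓘(ℝ, E) σ (Icc a b) t) :
    spacePart E (σ t, t) (velocityOn (𝓘(ℝ, E).prod 𝓘(ℝ, ℝ)) (fun t => (σ t, t)) a b t)
      = velocityOn 𝓘(ℝ, E) σ a b t := by
  rw [spacePart_apply, velocityOn, mfderivWithin_graph hab ht hσ]
  rfl

theorem timeForm_velocityOn {σ : ℝ → S} {a b t : ℝ} (hab : a < b) (ht : t ∈ Icc a b)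
    (hσ : MDifferentiableWithinAt 𝓘(ℝ, ℝ) 𝓘(ℝ, E) σ (Icc a b) t) :
    timeForm E (σ t, t) (velocityOn (𝓘(ℝ, E).prod 𝓘(ℝ, ℝ)) (fun t => (σ t, t)) a b t) = 1 := by
  rw [timeForm_apply, velocityOn, mfderivWithin_graph hab ht hσ]
  rfl

theorem velocityOn_graph_ne_zero {σ : ℝ → S} {a b t : ℝ} (hab : a < b) (ht : t ∈ Icc a b)
    (hσ : MDifferentiableWithinAt 𝓘(ℝ, ℝ) 𝓘(ℝ, E) σ (Icc a b) t) :
    velocityOn (𝓘(ℝ, E).prod 𝓘(ℝ, ℝ)) (fun t => (σ t, t)) a b t ≠ 0 := fun h => by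
  have h1 := timeForm_velocityOn hab ht hσ
  rw [h, map_zero] at h1
  exact zero_ne_one h1

variable [RiemannianBundle (fun x : S => TangentSpace 𝓘(ℝ, E) x)]

/-- The velocity of `σ` on `[a, b]` satisfies `g₀(σ', σ') + 2 η(σ') = Λ + ε`: the curve `(σ(t), t)`
is null for `g_ε`. -/
def HasNullGraph (η : ∀ x : S, TangentSpace 𝓘(ℝ, E) x →L[ℝ] ℝ) (Λ : S → ℝ) (ε : ℝ)
    (σ : ℝ → S) (a b : ℝ) : Prop :=
  ∀ t ∈ Icc a b, inner ℝ (velocityOn 𝓘(ℝ, E) σ a b t) (velocityOn 𝓘(ℝ, E) σ a b t)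
    + 2 * η (σ t) (velocityOn 𝓘(ℝ, E) σ a b t) = Λ (σ t) + ε

variable {η : ∀ x : S, TangentSpace 𝓘(ℝ, E) x →L[ℝ] ℝ} {Λ : S → ℝ} {ε : ℝ}

theorem stationaryMetric_velocityOn {σ : ℝ → S} {a b t : ℝ} (hab : a < b) (ht : t ∈ Icc a b)
    (hσ : MDifferentiableWithinAt 𝓘(ℝ, ℝ) 𝓘(ℝ, E) σ (Icc a b) t) :
    stationaryMetric η Λ ε (σ t, t)
      (velocityOn (𝓘(ℝ, E).prod 𝓘(ℝ, ℝ)) (fun t => (σ t, t)) a b t)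
      (velocityOn (𝓘(ℝ, E).prod 𝓘(ℝ, ℝ)) (fun t => (σ t, t)) a b t)
      = inner ℝ (velocityOn 𝓘(ℝ, E) σ a b t) (velocityOn 𝓘(ℝ, E) σ a b t)
        + 2 * η (σ t) (velocityOn 𝓘(ℝ, E) σ a b t) - (Λ (σ t) + ε) := by
  rw [stationaryMetric_apply, spacePart_velocityOn hab ht hσ, timeForm_velocityOn hab ht hσ]
  ring

theorem IsLightlikeOn.hasNullGraph {σ : ℝ → S} {a b : ℝ} (hab : a < b)
    (hσ : ContMDiffOn 𝓘(ℝ, ℝ) 𝓘(ℝ, E) ∞ σ (Icc a b))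
    (h : IsLightlikeOn (stationaryMetric η Λ ε) (fun t => (σ t, t)) a b) :
    HasNullGraph η Λ ε σ a b := fun t ht => by
  have h1 := (h t ht).2
  rw [stationaryMetric_velocityOn hab ht ((hσ t ht).mdifferentiableWithinAt (by simp))] at h1
  linarith

theorem HasNullGraph.isLightlikeOn {σ : ℝ → S} {a b : ℝ} (hab : a < b)
    (hσ : ContMDiffOn 𝓘(ℝ, ℝ) 𝓘(ℝ, E) ∞ σ (Icc a b)) (h : HasNullGraph η Λ ε σ a b) :
    IsLightlikeOn (stationaryMetric η Λ ε) (fun t => (σ t, t)) a b := fun t ht => by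
  have h1 := (hσ t ht).mdifferentiableWithinAt (by simp)
  refine ⟨velocityOn_graph_ne_zero hab ht h1, ?_⟩
  rw [stationaryMetric_velocityOn hab ht h1, h t ht, sub_self]

theorem HasNullGraph.isFuturePointingOn {σ : ℝ → S} {a b : ℝ} (hab : a < b)
    (hσ : ContMDiffOn 𝓘(ℝ, ℝ) 𝓘(ℝ, E) ∞ σ (Icc a b)) (h : HasNullGraph η Λ ε σ a b) :
    IsFuturePointingOn (stationaryMetric η Λ ε) (fun t => (σ t, t)) a b := fun t ht => by
  have h1 := (hσ t ht).mdifferentiableWithinAt (by simp)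
  have h2 := h.isLightlikeOn hab hσ t ht
  exact ⟨h2.1, h2.2.le, by rw [timeForm_velocityOn hab ht h1]; exact one_pos⟩

variable [IsManifold 𝓘(ℝ, E) ∞ S]

/-- The null condition in a chart. -/
theorem chart_null_iff {σ : ℝ → S} {a b t : ℝ} (hab : a < b) (ht : t ∈ Icc a b) {p : S}
    (hσ : ContinuousOn σ (Icc a b)) (hsrc : σ t ∈ (chartAt E p).source) {w : E}
    (hw : HasDerivWithinAt (chartCurve E p σ) w (Icc a b) t) :
    chartMetric E p (chartCurve E p σ t) w w + 2 * chartForm η p (chartCurve E p σ t) w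
        = chartFun Λ p (chartCurve E p σ t) + ε ↔
      inner ℝ (velocityOn 𝓘(ℝ, E) σ a b t) (velocityOn 𝓘(ℝ, E) σ a b t)
        + 2 * η (σ t) (velocityOn 𝓘(ℝ, E) σ a b t) = Λ (σ t) + ε := by
  set φ := extChartAt 𝓘(ℝ, E) p
  set x := chartCurve E p σ t with hx
  have hxt : x ∈ φ.target := φ.map_source (by rwa [extChartAt_source])
  have hq : φ.symm x = σ t := φ.left_inv (by rwa [extChartAt_source])
  have hu : UniqueMDiffWithinAt 𝓘(ℝ, ℝ) (Icc a b) t :=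
    ((uniqueDiffOn_Icc hab) t ht).uniqueMDiffWithinAt
  have h1 : HasMFDerivAt 𝓘(ℝ, E) 𝓘(ℝ, E) φ.symm x (chartFrame E p x) :=
    (((contMDiffOn_extChartAt_symm (I := 𝓘(ℝ, E)) (n := ∞) p).contMDiffAt
      ((isOpen_extChartAt_target p).mem_nhds hxt)).mdifferentiableAt (by simp)).hasMFDerivAt
  have h2 : HasMFDerivWithinAt 𝓘(ℝ, ℝ) 𝓘(ℝ, E) (chartCurve E p σ) (Icc a b) t
    (ContinuousLinearMap.toSpanSingleton ℝ w) := hw.hasFDerivWithinAt.hasMFDerivWithinAt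
  have h3 := h1.comp_hasMFDerivWithinAt t h2
  have h4 : mfderivWithin 𝓘(ℝ, ℝ) 𝓘(ℝ, E) (φ.symm ∘ chartCurve E p σ) (Icc a b) t
      = mfderivWithin 𝓘(ℝ, ℝ) 𝓘(ℝ, E) σ (Icc a b) t := by
    refine Filter.EventuallyEq.mfderivWithin_eq ?_ hq
    filter_upwards [eventually_mem_chart_source hσ p ht hsrc] with r hr
    exact φ.left_inv (by rw [extChartAt_source]; exact hr.2)
  have hv : (velocityOn 𝓘(ℝ, E) σ a b t : E) = (chartFrame E p x w : E) := by
    rw [velocityOn, ← h4, h3.mfderivWithin hu]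
    change chartFrame E p x ((1 : ℝ) • w) = _
    rw [one_smul]
  -- the fibers over the equal points `φ.symm x` and `σ t` are identified
  have transport : ∀ (q : S), φ.symm x = q → ∀ v : TangentSpace 𝓘(ℝ, E) q,
      (v : E) = (chartFrame E p x w : E) →
      (chartMetric E p x w w + 2 * chartForm η p x w = chartFun Λ p x + ε ↔
        inner ℝ v v + 2 * η q v = Λ q + ε) := by
    rintro q rfl v rfl
    rfl
  exact transport (σ t) hq _ hv

/-- Over a compact set, the vectors `v` with `g₀(v, v) + 2 η(v) = Λ + ε` are bounded, uniformly in
`ε ≤ 1`. -/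
theorem exists_norm_le_of_null [FiniteDimensional ℝ E]
    (hd : ∀ p : S, IsStationaryData (extChartAt 𝓘(ℝ, E) p).target (chartMetric E p)
      (chartForm η p) (chartFun (E := E) Λ p)) {K : Set S} (hK : IsCompact K) :
    ∃ C : ℝ, 0 ≤ C ∧ ∀ q ∈ K, ∀ ε ≤ (1 : ℝ), ∀ v : TangentSpace 𝓘(ℝ, E) q,
      inner ℝ v v + 2 * η q v = Λ q + ε → ‖v‖ ≤ C := by
  have : ProperSpace E := FiniteDimensional.proper_real E
  refine hK.induction_on (p := fun K => ∃ C : ℝ, 0 ≤ C ∧ ∀ q ∈ K, ∀ ε ≤ (1 : ℝ),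
    ∀ v : TangentSpace 𝓘(ℝ, E) q, inner ℝ v v + 2 * η q v = Λ q + ε → ‖v‖ ≤ C) ?_ ?_ ?_ ?_
  · exact ⟨0, le_rfl, fun q hq => hq.elim⟩
  · rintro s t hst ⟨C, hC, h⟩
    exact ⟨C, hC, fun q hq => h q (hst hq)⟩
  · rintro s t ⟨C, hC, h⟩ ⟨C', hC', h'⟩
    refine ⟨max C C', le_max_of_le_left hC, fun q hq ε hε v hv => ?_⟩
    rcases hq with hq | hq
    · exact (h q hq ε hε v hv).trans (le_max_left _ _)
    · exact (h' q hq ε hε v hv).trans (le_max_right _ _)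
  · intro p _
    set φ := extChartAt 𝓘(ℝ, E) p with hφ
    obtain ⟨R, hR, hRsub⟩ := Metric.nhds_basis_closedBall.mem_iff.1
      (extChartAt_target_mem_nhds (I := 𝓘(ℝ, E)) p)
    have hcpt : IsCompact (Metric.closedBall (φ p) R) := isCompact_closedBall _ _
    obtain ⟨M, hM⟩ := exists_norm_velocity_le (hd p) hcpt hRsub
    obtain ⟨G, hG⟩ := hcpt.exists_bound_of_continuousOn
      ((hd p).contDiffOn_metric.continuousOn.mono hRsub)
    refine ⟨φ.source ∩ φ ⁻¹' Metric.closedBall (φ p) R, ?_, √(|G| * M ^ 2),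
      Real.sqrt_nonneg _, ?_⟩
    · refine mem_nhdsWithin_of_mem_nhds (inter_mem (extChartAt_source_mem_nhds p) ?_)
      exact (continuousAt_extChartAt p).preimage_mem_nhds (Metric.closedBall_mem_nhds _ hR)
    · rintro q ⟨hq, hqR⟩
      obtain ⟨x, hx, rfl⟩ : ∃ x ∈ Metric.closedBall (φ p) R, φ.symm x = q :=
        ⟨φ q, hqR, φ.left_inv hq⟩
      intro ε hε v hv
      obtain ⟨w, rfl⟩ := (isInvertible_chartFrame p (hRsub hx)).surjective v
      have hw := hM x hx ε hε w hv
      refine Real.le_sqrt_of_sq_le ?_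
      rw [← real_inner_self_eq_norm_sq]
      calc chartMetric E p x w w ≤ ‖chartMetric E p x w w‖ := le_abs_self _
        _ ≤ ‖chartMetric E p x‖ * ‖w‖ * ‖w‖ := ContinuousLinearMap.le_opNorm₂ _ _ _
        _ ≤ |G| * M * M := by
          have h0 := (norm_nonneg w).trans hw
          gcongr
          exact (hG x hx).trans (le_abs_self G)
        _ = |G| * M ^ 2 := by ring

end Topological

end Velocities

/-! ### Arrival times and the distances of the Randers metrics -/

section RandersBounds

open MeasureTheory

variable {E : Type*} [NormedAddCommGroup E] [NormedSpace ℝ E]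

section Topological

variable {S : Type*} [TopologicalSpace S] [ChartedSpace E S]
  [RiemannianBundle (fun x : S => TangentSpace 𝓘(ℝ, E) x)]
  {η : ∀ x : S, TangentSpace 𝓘(ℝ, E) x →L[ℝ] ℝ} {Λ : S → ℝ}

/-- The Randers norm `F_δ` of the spatial part of a null vector of `g_ε` is at most its time
component, if `ε ≤ δ`. -/
theorem randersNorm_smul_le {ε δ : ℝ} (hεδ : ε ≤ δ) {x : S} {v : TangentSpace 𝓘(ℝ, E) x}
    (hv : inner ℝ v v + 2 * η x v = Λ x + ε) {l : ℝ} (hl : 0 ≤ l) :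
    randersNorm η Λ δ x (l • v) ≤ l := by
  have hq : (0 : ℝ) ≤ inner ℝ v v := real_inner_self_nonneg
  have hin : inner ℝ (l • v) (l • v) = l ^ 2 * inner ℝ v v := by
    rw [real_inner_smul_left, real_inner_smul_right]; ring
  have hη : η x (l • v) = l * η x v := by rw [map_smul, smul_eq_mul]
  rw [randersNorm, hin, hη]
  set q : ℝ := inner ℝ v v
  set e : ℝ := η x v
  have h1 : l * (q + e) ≤ √((Λ x + δ) * (l ^ 2 * q) + (l * e) ^ 2) := by
    refine Real.le_sqrt_of_sq_le ?_
    have h2 : (l * (q + e)) ^ 2 = (Λ x + ε) * (l ^ 2 * q) + (l * e) ^ 2 := by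
      rw [← hv]; ring
    rw [h2]
    gcongr
  have h3 : l * q ≤ -(l * e) + √((Λ x + δ) * (l ^ 2 * q) + (l * e) ^ 2) := by linarith
  have h4 : 0 ≤ l * q := mul_nonneg hl hq
  refine div_le_of_le_mul₀ (h4.trans h3) hl ?_
  calc l ^ 2 * q = l * (l * q) := by ring
    _ ≤ _ := mul_le_mul_of_nonneg_left h3 hl

/-- Along a null curve of `g_ε` the `F_δ`-distance is bounded by the elapsed time, if `ε ≤ δ`. -/
theorem randersDist_le_of_hasNullGraph {ε δ : ℝ} (hεδ : ε ≤ δ) {σ : ℝ → S} {a b : ℝ}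
    (hσ : ContMDiffOn 𝓘(ℝ, ℝ) 𝓘(ℝ, E) ∞ σ (Icc a b)) (hn : HasNullGraph η Λ ε σ a b) {u v : ℝ}
    (hu : u ∈ Icc a b) (hv : v ∈ Icc a b) (huv : u ≤ v) :
    randersDist η Λ δ (σ u) (σ v) ≤ ENNReal.ofReal (v - u) := by
  set f : ℝ → ℝ := fun s => u + s * (v - u) with hf
  have hfm : MapsTo f (Icc 0 1) (Icc a b) := fun s hs => by
    have h1 : 0 ≤ s * (v - u) := mul_nonneg hs.1 (by linarith)
    have h2 : s * (v - u) ≤ 1 * (v - u) := mul_le_mul_of_nonneg_right hs.2 (by linarith)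
    exact ⟨by linarith [hu.1], by linarith [hv.2]⟩
  have hfs : ContDiff ℝ ∞ f := contDiff_const.add (contDiff_id.mul contDiff_const)
  have hfd : ∀ s, HasDerivAt f (v - u) s := fun s => by
    exact (((hasDerivAt_id s).mul_const (v - u)).const_add u).congr_deriv (one_mul _)
  have hc : ContMDiffOn 𝓘(ℝ, ℝ) 𝓘(ℝ, E) ∞ (σ ∘ f) (Icc 0 1) :=
    hσ.comp hfs.contMDiff.contMDiffOn hfm
  have hpath : IsPiecewiseSmoothPath E (σ u) (σ v) (σ ∘ f) := by
    refine ⟨hc.continuousOn, by simp [hf], by simp [hf], 1, fun i => i, by simp, by simp,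
      fun i _ => by simp, fun i hi => ?_⟩
    obtain rfl : i = 0 := by omega
    simpa using hc
  have hbound : ∀ s ∈ Ioo (0 : ℝ) 1, ENNReal.ofReal (randersNorm η Λ δ ((σ ∘ f) s)
      (mfderiv 𝓘(ℝ, ℝ) 𝓘(ℝ, E) (σ ∘ f) s (1 : ℝ))) ≤ ENNReal.ofReal (v - u) := by
    intro s hs
    have hs' := Ioo_subset_Icc_self hs
    have h1 := ((hσ _ (hfm hs')).mdifferentiableWithinAt (by simp)).hasMFDerivWithinAt
    have h2 : HasMFDerivWithinAt 𝓘(ℝ, ℝ) 𝓘(ℝ, ℝ) f (Icc 0 1) s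
      (ContinuousLinearMap.toSpanSingleton ℝ (v - u)) :=
      (hfd s).hasDerivWithinAt.hasFDerivWithinAt.hasMFDerivWithinAt
    have h3 := (h1.comp s h2 hfm).hasMFDerivAt (Icc_mem_nhds hs.1 hs.2)
    have h4 : mfderiv 𝓘(ℝ, ℝ) 𝓘(ℝ, E) (σ ∘ f) s (1 : ℝ)
        = (v - u) • velocityOn 𝓘(ℝ, E) σ a b (f s) := by
      have h5 : ∀ A : ℝ →L[ℝ] E, A ((1 : ℝ) • (v - u)) = (v - u) • A 1 := fun A => by
        rw [← map_smul, smul_eq_mul, smul_eq_mul, mul_comm]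
      rw [h3.mfderiv]
      exact h5 _
    rw [h4]
    exact ENNReal.ofReal_le_ofReal
      (randersNorm_smul_le hεδ (hn _ (hfm hs')) (sub_nonneg.2 huv))
  calc randersDist η Λ δ (σ u) (σ v) ≤ randersLength η Λ δ (σ ∘ f) := iInf₂_le _ hpath
    _ ≤ ∫⁻ _ in Ioo (0 : ℝ) 1, ENNReal.ofReal (v - u) :=
      setLIntegral_mono measurable_const hbound
    _ = ENNReal.ofReal (v - u) := by simp

/-- A null curve stays in the intersection of the forward ball about its starting point and the
backward ball about its end point. -/
theorem mem_forwardBall_inter_backwardBall {ε δ : ℝ} (hεδ : ε ≤ δ) {σ : ℝ → S} {a b r : ℝ}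
    (hσ : ContMDiffOn 𝓘(ℝ, ℝ) 𝓘(ℝ, E) ∞ σ (Icc a b)) (hn : HasNullGraph η Λ ε σ a b)
    (hr0 : 0 < r) (hr : b - a < r) {t : ℝ} (ht : t ∈ Icc a b) :
    σ t ∈ forwardBall η Λ δ (σ a) r ∩ backwardBall η Λ δ (σ b) r := by
  have hab : a ≤ b := ht.1.trans ht.2
  constructor
  · exact (randersDist_le_of_hasNullGraph hεδ hσ hn (left_mem_Icc.2 hab) ht ht.1).trans_lt
      ((ENNReal.ofReal_lt_ofReal_iff hr0).2 (by linarith [ht.2]))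
  · exact (randersDist_le_of_hasNullGraph hεδ hσ hn ht (right_mem_Icc.2 hab) ht.2).trans_lt
      ((ENNReal.ofReal_lt_ofReal_iff hr0).2 (by linarith [ht.1]))

end Topological

section Metric

variable {S : Type*} [MetricSpace S] [ChartedSpace E S]
  [RiemannianBundle (fun x : S => TangentSpace 𝓘(ℝ, E) x)] [IsRiemannianManifold 𝓘(ℝ, E) S]

/-- A curve of speed at most `C` is `C`-Lipschitz. -/
theorem dist_le_of_norm_velocityOn_le {σ : ℝ → S} {a b C : ℝ} (hC : 0 ≤ C)
    (hσ : ContMDiffOn 𝓘(ℝ, ℝ) 𝓘(ℝ, E) ∞ σ (Icc a b))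
    (hv : ∀ t ∈ Icc a b, ‖velocityOn 𝓘(ℝ, E) σ a b t‖ ≤ C) {s t : ℝ} (hs : s ∈ Icc a b)
    (ht : t ∈ Icc a b) : dist (σ s) (σ t) ≤ C * |s - t| := by
  wlog hst : s ≤ t generalizing s t
  · rw [dist_comm, abs_sub_comm]
    exact this ht hs (le_of_not_ge hst)
  have hsub : Icc s t ⊆ Icc a b := Icc_subset_Icc hs.1 ht.2
  have h1 : edist (σ s) (σ t) ≤ Manifold.pathELength 𝓘(ℝ, E) σ s t := by
    rw [IsRiemannianManifold.out (I := 𝓘(ℝ, E))]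
    exact Manifold.riemannianEDist_le_pathELength
      ((hσ.mono hsub).of_le (by exact_mod_cast le_top)) rfl rfl hst
  have h2 : Manifold.pathELength 𝓘(ℝ, E) σ s t ≤ ENNReal.ofReal (C * |s - t|) := by
    rw [Manifold.pathELength_eq_lintegral_mfderiv_Ioo]
    calc _ ≤ ∫⁻ _ in Ioo s t, ENNReal.ofReal C := by
          refine setLIntegral_mono measurable_const fun r hr => ?_
          have hr' : r ∈ Icc a b := hsub (Ioo_subset_Icc_self hr)
          have h3 : Icc a b ∈ 𝓝 r :=
            Icc_mem_nhds (hs.1.trans_lt hr.1) (hr.2.trans_le ht.2)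
          rw [← mfderivWithin_of_mem_nhds h3, ← ofReal_norm]
          exact ENNReal.ofReal_le_ofReal (hv r hr')
      _ = ENNReal.ofReal (C * |s - t|) := by
          rw [setLIntegral_const, Real.volume_Ioo, ← ENNReal.ofReal_mul hC, abs_sub_comm,
            abs_of_nonneg (sub_nonneg.2 hst)]
  have h3 := h1.trans h2
  rwa [edist_dist, ENNReal.ofReal_le_ofReal_iff (by positivity)] at h3

end Metric

end RandersBounds

/-! ### Limits of light rays -/

section Limits

variable {E : Type*} [NormedAddCommGroup E] [NormedSpace ℝ E]
  {S : Type*} [MetricSpace S] [ChartedSpace E S] [IsManifold 𝓘(ℝ, E) ∞ S]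
  [RiemannianBundle (fun x : S => TangentSpace 𝓘(ℝ, E) x)]
  {η : ∀ x : S, TangentSpace 𝓘(ℝ, E) x →L[ℝ] ℝ} {Λ : S → ℝ}

/-- The coordinate expression of a null solution of the equation of the light rays. -/
theorem SolvesRayEquation.isRayOn {ε : ℝ} {σ : ℝ → S} {κ : ℝ → ℝ} {a b : ℝ} (hab : a < b)
    (hσ : ContinuousOn σ (Icc a b)) (hs : SolvesRayEquation η Λ ε σ κ (Icc a b))
    (hn : HasNullGraph η Λ ε σ a b) {p : S} {J : Set ℝ} (hJ : J ⊆ Icc a b)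
    (hsrc : ∀ t ∈ J, σ t ∈ (chartAt E p).source) :
    IsRayOn (chartMetric E p) (chartForm η p) (chartFun Λ p) ε (chartCurve E p σ)
      (derivWithin (chartCurve E p σ) (Icc a b)) J where
  hasDeriv_pos t ht := (hs p t (hJ ht) (hsrc t ht)).1.mono hJ
  hasDeriv_vel t ht := (hs p t (hJ ht) (hsrc t ht)).2.1.mono hJ
  null t ht := (chart_null_iff hab (hJ ht) hσ (hsrc t ht) (hs p t (hJ ht) (hsrc t ht)).1).2
    (hn t (hJ ht))

variable [FiniteDimensional ℝ E]

/-- Uniform limits of light rays, rescaled to the time interval `[0, 1]`, are locally light rays in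
a chart, and the rates `κ` converge. -/
theorem exists_eventually_limit_in_chart
    (hd : ∀ p : S, IsStationaryData (extChartAt 𝓘(ℝ, E) p).target (chartMetric E p)
      (chartForm η p) (chartFun (E := E) Λ p))
    {a : ℝ} {d ε : ℕ → ℝ} {σ : ℕ → ℝ → S} {κ : ℕ → ℝ → ℝ} {d₀ ε₀ : ℝ} {f : ℝ → S}
    (hdpos : ∀ n, 0 < d n) (hd₀ : 0 < d₀) (hdlim : Tendsto d atTop (𝓝 d₀))
    (hε : ∀ n, ε n ∈ Icc (0 : ℝ) 1) (hεlim : Tendsto ε atTop (𝓝 ε₀))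
    (hσ : ∀ n, ContinuousOn (σ n) (Icc a (a + d n)))
    (hs : ∀ n, SolvesRayEquation η Λ (ε n) (σ n) (κ n) (Icc a (a + d n)))
    (hn : ∀ n, HasNullGraph η Λ (ε n) (σ n) a (a + d n))
    (hf : ContinuousOn f (Icc 0 1))
    (hlim : TendstoUniformlyOn (fun n s => σ n (a + d n * s)) f atTop (Icc 0 1))
    (p : S) {s₀ : ℝ} (hs₀ : s₀ ∈ Icc (0 : ℝ) 1) (hsrc : f s₀ ∈ (chartAt E p).source) :
    ∃ W : ℝ → E, ∀ᶠ s in 𝓝[Icc 0 1] s₀,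
      HasDerivWithinAt (chartCurve E p f) (d₀ • W s) (Icc 0 1) s ∧
      HasDerivWithinAt W (d₀ • chartRayField η Λ p (chartCurve E p f s, W s, ε₀)) (Icc 0 1) s ∧
      chartMetric E p (chartCurve E p f s) (W s) (W s)
        + 2 * chartForm η p (chartCurve E p f s) (W s)
          = chartFun Λ p (chartCurve E p f s) + ε₀ ∧
      Tendsto (fun n => κ n (a + d n * s)) atTop
        (𝓝 (chartRayRate η Λ p (chartCurve E p f s, W s, ε₀))) := by
  have : ProperSpace E := FiniteDimensional.proper_real E
  set φ := extChartAt 𝓘(ℝ, E) p with hφ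
  have hsrc' : f s₀ ∈ φ.source := by rwa [extChartAt_source]
  -- a closed coordinate ball about `f s₀`, and an open set of `S` mapped into it
  obtain ⟨r, hr, hrsub⟩ := Metric.nhds_basis_closedBall.mem_iff.1
    ((isOpen_extChartAt_target p).mem_nhds (φ.map_source hsrc'))
  set B := Metric.closedBall (φ (f s₀)) r with hB
  have hBcpt : IsCompact B := isCompact_closedBall _ _
  have hV : φ.source ∩ φ ⁻¹' B ∈ 𝓝 (f s₀) :=
    inter_mem (extChartAt_source_mem_nhds' hsrc')
      ((continuousAt_extChartAt' hsrc').preimage_mem_nhds (Metric.closedBall_mem_nhds _ hr))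
  obtain ⟨ρ, hρ, hρsub⟩ := Metric.mem_nhds_iff.1 hV
  -- a relative neighborhood of `s₀` in which all the late curves stay in the coordinate ball
  obtain ⟨δ, hδ, hδsub⟩ := Metric.mem_nhdsWithin_iff.1
    ((hf s₀ hs₀).preimage_mem_nhdsWithin (Metric.ball_mem_nhds (f s₀) (half_pos hρ)))
  set J : Set ℝ := Icc 0 1 ∩ Metric.ball s₀ δ with hJ
  have hJsub : J ⊆ Icc 0 1 := inter_subset_left
  have hJs₀ : J ∈ 𝓝[Icc 0 1] s₀ :=
    inter_mem self_mem_nhdsWithin (mem_nhdsWithin_of_mem_nhds (Metric.ball_mem_nhds _ hδ))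
  have hJnhds : ∀ s ∈ J, J ∈ 𝓝[Icc 0 1] s := fun s hs =>
    inter_mem self_mem_nhdsWithin (mem_nhdsWithin_of_mem_nhds (Metric.isOpen_ball.mem_nhds hs.2))
  have hJconv : Convex ℝ J := (convex_Icc 0 1).inter (convex_ball _ _)
  have hJdiff : UniqueDiffOn ℝ J :=
    (uniqueDiffOn_Icc zero_lt_one).inter Metric.isOpen_ball
  have hfJ : ∀ s ∈ J, f s ∈ Metric.ball (f s₀) (ρ / 2) := fun s hs => hδsub ⟨hs.2, hs.1⟩
  obtain ⟨N, hN⟩ := eventually_atTop.1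
    (Metric.tendstoUniformlyOn_iff.1 hlim (ρ / 2) (half_pos hρ))
  have hmemV : ∀ n, ∀ s ∈ J, σ (n + N) (a + d (n + N) * s) ∈ φ.source ∩ φ ⁻¹' B := by
    intro n s hs
    refine hρsub ?_
    have h1 := hN (n + N) (Nat.le_add_left _ _) s (hJsub hs)
    have h2 := hfJ s hs
    rw [Metric.mem_ball] at h2 ⊢
    rw [dist_comm] at h1
    linarith [dist_triangle (σ (n + N) (a + d (n + N) * s)) (f s) (f s₀)]
  -- the time changes `s ↦ a + d n * s`
  have hθ : ∀ n, MapsTo (fun s => a + d n * s) (Icc 0 1) (Icc a (a + d n)) := fun n s hs =>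
    ⟨by nlinarith [hdpos n, hs.1], by nlinarith [hdpos n, hs.2]⟩
  have hθd : ∀ n s, HasDerivAt (fun s => a + d n * s) (d n) s := fun n s =>
    (((hasDerivAt_id s).const_mul (d n)).const_add a).congr_deriv (mul_one _)
  set x : ℕ → ℝ → E := fun n s => chartCurve E p (σ (n + N)) (a + d (n + N) * s) with hx
  set w : ℕ → ℝ → E := fun n s => derivWithin (chartCurve E p (σ (n + N)))
    (Icc a (a + d (n + N))) (a + d (n + N) * s) with hw
  have hray : ∀ n, IsRayOn (chartMetric E p) (chartForm η p) (chartFun Λ p) (ε (n + N))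
      (chartCurve E p (σ (n + N)))
      (derivWithin (chartCurve E p (σ (n + N))) (Icc a (a + d (n + N))))
      ((fun s => a + d (n + N) * s) '' J) := fun n => by
    refine (hs (n + N)).isRayOn (by linarith [hdpos (n + N)]) (hσ _) (hn _)
      (image_subset_iff.2 fun s hs => hθ _ (hJsub hs)) ?_
    rintro _ ⟨s, hsJ, rfl⟩
    have := (hmemV n s hsJ).1
    rwa [extChartAt_source] at this
  obtain ⟨M, hM⟩ := exists_norm_velocity_le (hd p) hBcpt hrsub
  set D : Set (E × E × ℝ) := B ×ˢ Metric.closedBall (0 : E) M ×ˢ Icc (0 : ℝ) 1 with hD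
  have hDU : ∀ q ∈ D, q.1 ∈ φ.target ∧ 0 ≤ q.2.2 := fun q hq => ⟨hrsub hq.1, hq.2.2.1⟩
  have hmem : ∀ n, ∀ s ∈ J, (x n s, w n s, ε (n + N)) ∈ D := fun n s hsJ => by
    refine ⟨(hmemV n s hsJ).2, ?_, hε _⟩
    rw [mem_closedBall_zero_iff]
    exact hM _ (hmemV n s hsJ).2 _ (hε _).2 _ ((hray n).null _ (mem_image_of_mem _ hsJ))
  have hxlim : ∀ s ∈ J, Tendsto (fun n => x n s) atTop (𝓝 (chartCurve E p f s)) := by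
    intro s hsJ
    have h1 : f s ∈ φ.source :=
      (hρsub (Metric.ball_subset_ball (by linarith) (hfJ s hsJ))).1
    exact ((continuousAt_extChartAt' h1).tendsto.comp (hlim.tendsto_at (hJsub hsJ))).comp
      (tendsto_add_atTop_nat N)
  obtain ⟨W, hW⟩ := exists_limit_of_second_order_solutions hJconv hJdiff
    (hBcpt.prod ((isCompact_closedBall _ _).prod isCompact_Icc))
    ((convex_closedBall _ _).prod ((convex_closedBall _ _).prod (convex_Icc _ _)))
    (f := chartRayField η Λ p) (x := x) (w := w) (X := chartCurve E p f)
    (d := fun n => d (n + N)) (e := fun n => ε (n + N))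
    (fun q hq => ((contDiffAt_rayField (hd p) (hDU q hq).1 (hDU q hq).2).of_le
      (by exact_mod_cast le_top)).contDiffWithinAt)
    (hdlim.comp (tendsto_add_atTop_nat N)) hd₀.ne' (hεlim.comp (tendsto_add_atTop_nat N)) hmem
    (fun n s hsJ => HasDerivWithinAt.scomp (h := fun s => a + d (n + N) * s) s
      ((hray n).hasDeriv_pos _ (mem_image_of_mem _ hsJ)) (hθd _ s).hasDerivWithinAt
      (mapsTo_image _ _))
    (fun n s hsJ => HasDerivWithinAt.scomp (h := fun s => a + d (n + N) * s) s
      ((hray n).hasDeriv_vel _ (mem_image_of_mem _ hsJ)) (hθd _ s).hasDerivWithinAt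
      (mapsTo_image _ _)) hxlim
  refine ⟨W, mem_of_superset hJs₀ fun s hsJ => ?_⟩
  obtain ⟨hWs, hDs, hX', hW'⟩ := hW s hsJ
  have htriple : Tendsto (fun n => (x n s, w n s, ε (n + N))) atTop
      (𝓝 (chartCurve E p f s, W s, ε₀)) :=
    (hxlim s hsJ).prodMk_nhds (hWs.prodMk_nhds (hεlim.comp (tendsto_add_atTop_nat N)))
  have hU := (hd p).isOpen.mem_nhds (hDU _ hDs).1
  refine ⟨hX'.mono_of_mem_nhdsWithin (hJnhds s hsJ), hW'.mono_of_mem_nhdsWithin (hJnhds s hsJ),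
    ?_, ?_⟩
  · have hx1 : ContinuousAt (fun q : E × E × ℝ => q.1) (chartCurve E p f s, W s, ε₀) :=
      continuousAt_fst
    have hw1 : ContinuousAt (fun q : E × E × ℝ => q.2.1) (chartCurve E p f s, W s, ε₀) :=
      continuousAt_snd.fst
    have hg := ((hd p).contDiffOn_metric.continuousOn.continuousAt hU).comp hx1
    have hη := ((hd p).contDiffOn_form.continuousOn.continuousAt hU).comp hx1
    have hΛ := ((hd p).contDiffOn_fun.continuousOn.continuousAt hU).comp hx1
    refine tendsto_nhds_unique ((((hg.clm_apply hw1).clm_apply hw1).add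
      ((hη.clm_apply hw1).const_mul 2)).tendsto.comp htriple) ?_
    refine ((hΛ.add continuousAt_snd.snd).tendsto.comp htriple).congr fun n => ?_
    exact ((hray n).null _ (mem_image_of_mem _ hsJ)).symm
  · refine (tendsto_add_atTop_iff_nat N).1 ?_
    have hc := (continuous_snd.continuousAt.comp
      (contDiffAt_rayAcc (hd p) (hDU _ hDs).1 (hDU _ hDs).2).continuousAt).tendsto.comp htriple
    refine hc.congr fun n => ?_
    have h1 := (hmemV n s hsJ).1
    rw [extChartAt_source] at h1
    exact ((hs (n + N)) p _ (hθ _ (hJsub hsJ)) h1).2.2.symm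

/-- A uniform limit of light rays of `g_ε`, with `ε` and the durations converging, is a light
ray. -/
theorem exists_solvesRayEquation_of_tendstoUniformlyOn
    (hd : ∀ p : S, IsStationaryData (extChartAt 𝓘(ℝ, E) p).target (chartMetric E p)
      (chartForm η p) (chartFun (E := E) Λ p))
    {a : ℝ} {d ε : ℕ → ℝ} {σ : ℕ → ℝ → S} {κ : ℕ → ℝ → ℝ} {d₀ ε₀ : ℝ} {f : ℝ → S}
    (hdpos : ∀ n, 0 < d n) (hd₀ : 0 < d₀) (hdlim : Tendsto d atTop (𝓝 d₀))
    (hε : ∀ n, ε n ∈ Icc (0 : ℝ) 1) (hεlim : Tendsto ε atTop (𝓝 ε₀))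
    (hσ : ∀ n, ContinuousOn (σ n) (Icc a (a + d n)))
    (hs : ∀ n, SolvesRayEquation η Λ (ε n) (σ n) (κ n) (Icc a (a + d n)))
    (hn : ∀ n, HasNullGraph η Λ (ε n) (σ n) a (a + d n))
    (hf : ContinuousOn f (Icc 0 1))
    (hlim : TendstoUniformlyOn (fun n s => σ n (a + d n * s)) f atTop (Icc 0 1)) :
    ContinuousOn (fun t => f ((t - a) / d₀)) (Icc a (a + d₀)) ∧
      (∃ κ₀, SolvesRayEquation η Λ ε₀ (fun t => f ((t - a) / d₀)) κ₀ (Icc a (a + d₀))) ∧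
      HasNullGraph η Λ ε₀ (fun t => f ((t - a) / d₀)) a (a + d₀) := by
  set θ : ℝ → ℝ := fun t => (t - a) / d₀ with hθ
  have hab : a < a + d₀ := by linarith
  have hθm : MapsTo θ (Icc a (a + d₀)) (Icc 0 1) := fun t ht =>
    ⟨div_nonneg (by linarith [ht.1]) hd₀.le, (div_le_one hd₀).2 (by linarith [ht.2])⟩
  have hθd : ∀ t, HasDerivAt θ d₀⁻¹ t := fun t =>
    (((hasDerivAt_id t).sub_const a).div_const d₀).congr_deriv (one_div _)
  have hcont : ContinuousOn (fun t => f (θ t)) (Icc a (a + d₀)) :=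
    hf.comp (fun t _ => (hθd t).continuousAt.continuousWithinAt) hθm
  have key : ∀ p, ∀ t ∈ Icc a (a + d₀), f (θ t) ∈ (chartAt E p).source → ∃ w : E,
      HasDerivWithinAt (chartCurve E p (fun t => f (θ t))) w (Icc a (a + d₀)) t ∧
      HasDerivWithinAt (derivWithin (chartCurve E p (fun t => f (θ t))) (Icc a (a + d₀)))
        (chartRayField η Λ p (chartCurve E p (fun t => f (θ t)) t, w, ε₀)) (Icc a (a + d₀)) t ∧
      chartMetric E p (chartCurve E p (fun t => f (θ t)) t) w w
        + 2 * chartForm η p (chartCurve E p (fun t => f (θ t)) t) w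
          = chartFun Λ p (chartCurve E p (fun t => f (θ t)) t) + ε₀ ∧
      Tendsto (fun n => κ n (a + d n * θ t)) atTop
        (𝓝 (chartRayRate η Λ p (chartCurve E p (fun t => f (θ t)) t, w, ε₀))) := by
    intro p t ht hsrc
    obtain ⟨W, hW⟩ := exists_eventually_limit_in_chart hd hdpos hd₀ hdlim hε hεlim hσ hs hn hf
      hlim p (hθm ht) hsrc
    have hW' := ((hθd t).continuousAt.continuousWithinAt.tendsto_nhdsWithin hθm).eventually hW
    obtain ⟨-, h2, h3, h4⟩ := hW'.self_of_nhdsWithin ht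
    have h1 : ∀ᶠ r in 𝓝[Icc a (a + d₀)] t,
        HasDerivWithinAt (chartCurve E p (fun t => f (θ t))) (W (θ r)) (Icc a (a + d₀)) r := by
      filter_upwards [hW'] with r hr
      refine (hr.1.scomp r (hθd r).hasDerivWithinAt hθm).congr_deriv ?_
      rw [smul_smul, inv_mul_cancel₀ hd₀.ne', one_smul]
    have h5 : derivWithin (chartCurve E p (fun t => f (θ t))) (Icc a (a + d₀))
        =ᶠ[𝓝[Icc a (a + d₀)] t] fun r => W (θ r) := by
      filter_upwards [h1, self_mem_nhdsWithin] with r hr hrI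
      exact hr.derivWithin (uniqueDiffOn_Icc hab r hrI)
    refine ⟨W (θ t), h1.self_of_nhdsWithin ht, ?_, h3, h4⟩
    refine HasDerivWithinAt.congr_of_eventuallyEq ?_ h5 (h5.self_of_nhdsWithin ht)
    refine (h2.scomp t (hθd t).hasDerivWithinAt hθm).congr_deriv ?_
    rw [smul_smul, inv_mul_cancel₀ hd₀.ne', one_smul]
    rfl
  refine ⟨hcont, ⟨fun t => limUnder atTop (fun n => κ n (a + d n * θ t)), ?_⟩, ?_⟩
  · intro p t ht hsrc
    obtain ⟨w, h1, h2, -, h4⟩ := key p t ht hsrc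
    rw [h1.derivWithin (uniqueDiffOn_Icc hab t ht)]
    exact ⟨h1, h2, h4.limUnder_eq⟩
  · intro t ht
    obtain ⟨w, h1, -, h3, -⟩ := key (f (θ t)) t ht (mem_chart_source E _)
    exact (chart_null_iff hab ht hcont (mem_chart_source E _) h1).1 h3

end Limits

/-! ### Durations bounded away from zero -/

section Duration

variable {E : Type*} [NormedAddCommGroup E] [NormedSpace ℝ E] [FiniteDimensional ℝ E]
  {S : Type*} [MetricSpace S] [ChartedSpace E S] [IsManifold 𝓘(ℝ, E) ∞ S]
  [RiemannianBundle (fun x : S => TangentSpace 𝓘(ℝ, E) x)]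
  {η : ∀ x : S, TangentSpace 𝓘(ℝ, E) x →L[ℝ] ℝ} {Λ : S → ℝ}

/-- Uniformly Lipschitz light rays with the same end points cannot have durations tending to
zero. -/
theorem pos_of_tendsto_duration
    (hd : ∀ p : S, IsStationaryData (extChartAt 𝓘(ℝ, E) p).target (chartMetric E p)
      (chartForm η p) (chartFun (E := E) Λ p))
    {a C d₀ : ℝ} {d ε : ℕ → ℝ} {σ : ℕ → ℝ → S} {κ : ℕ → ℝ → ℝ} {x₀ x₁ : S} (hC : 0 ≤ C)
    (hdpos : ∀ n, 0 < d n) (hdlim : Tendsto d atTop (𝓝 d₀)) (hε : ∀ n, ε n ∈ Ioc (0 : ℝ) 1)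
    (hσ : ∀ n, ContinuousOn (σ n) (Icc a (a + d n)))
    (hs : ∀ n, SolvesRayEquation η Λ (ε n) (σ n) (κ n) (Icc a (a + d n)))
    (hn : ∀ n, HasNullGraph η Λ (ε n) (σ n) a (a + d n))
    (hlip : ∀ n, ∀ s ∈ Icc a (a + d n), ∀ t ∈ Icc a (a + d n),
      dist (σ n s) (σ n t) ≤ C * |s - t|)
    (h₀ : ∀ n, σ n a = x₀) (h₁ : ∀ n, σ n (a + d n) = x₁) : 0 < d₀ := by
  refine (ge_of_tendsto' hdlim fun n => (hdpos n).le).lt_of_ne ?_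
  rintro rfl
  have hdist : ∀ n, ∀ t ∈ Icc a (a + d n), dist (σ n t) x₀ ≤ C * d n := fun n t ht => by
    rw [← h₀ n]
    refine (hlip n t ht a (left_mem_Icc.2 (by linarith [hdpos n]))).trans ?_
    rw [abs_of_nonneg (by linarith [ht.1])]
    exact mul_le_mul_of_nonneg_left (by linarith [ht.2]) hC
  have hCd : Tendsto (fun n => C * d n) atTop (𝓝 0) := by simpa using hdlim.const_mul C
  -- the curves are loops, since their diameters tend to zero
  have hx : x₁ = x₀ := by
    refine dist_le_zero.1 (ge_of_tendsto' hCd fun n => ?_)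
    rw [← h₁ n]
    exact hdist n _ (right_mem_Icc.2 (by linarith [hdpos n]))
  subst hx
  set φ := extChartAt 𝓘(ℝ, E) x₁ with hφ
  obtain ⟨R, hR, hRsub⟩ := Metric.nhds_basis_closedBall.mem_iff.1
    (extChartAt_target_mem_nhds (I := 𝓘(ℝ, E)) x₁)
  obtain ⟨δ, hδ, hloop⟩ := exists_pos_le_duration_of_loop (hd x₁) hR hRsub
  have hV : φ.source ∩ φ ⁻¹' Metric.closedBall (φ x₁) (R / 2) ∈ 𝓝 x₁ :=
    inter_mem (extChartAt_source_mem_nhds x₁)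
      ((continuousAt_extChartAt x₁).preimage_mem_nhds (Metric.closedBall_mem_nhds _ (half_pos hR)))
  obtain ⟨ρ, hρ, hρsub⟩ := Metric.mem_nhds_iff.1 hV
  obtain ⟨n, hnρ, hnδ⟩ :=
    ((hCd.eventually (gt_mem_nhds hρ)).and (hdlim.eventually (gt_mem_nhds hδ))).exists
  have hmem : ∀ t ∈ Icc a (a + d n), σ n t ∈ φ.source ∩ φ ⁻¹' Metric.closedBall (φ x₁) (R / 2) :=
    fun t ht => hρsub ((hdist n t ht).trans_lt hnρ)
  have hab : a < a + d n := by linarith [hdpos n]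
  have hray := (hs n).isRayOn hab (hσ n) (hn n) (p := x₁) Subset.rfl fun t ht => by
    have := (hmem t ht).1
    rwa [extChartAt_source] at this
  have := hloop (ε n) (hε n) _ _ a (a + d n) hab (fun t ht => (hmem t ht).2) hray
    (congrArg φ (h₀ n)) (congrArg φ (h₁ n))
  linarith

end Duration

/-! ### Compactness of families of curves with varying domains -/

section Compactness

variable {S : Type*} [MetricSpace S]

/-- The Arzelà–Ascoli theorem for curves on `[0, 1]` with a common Lipschitz constant and values
in a compact set. -/
theorem exists_subseq_tendstoUniformlyOn_Icc {K : Set S} (hK : IsCompact K) {L : ℝ} (hL : 0 ≤ L)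
    {F : ℕ → ℝ → S} (hFK : ∀ n, ∀ s ∈ Icc (0 : ℝ) 1, F n s ∈ K)
    (hF : ∀ n, ∀ s ∈ Icc (0 : ℝ) 1, ∀ t ∈ Icc (0 : ℝ) 1, dist (F n s) (F n t) ≤ L * |s - t|) :
    ∃ (φ : ℕ → ℕ) (f : ℝ → S), StrictMono φ ∧
      (∀ s ∈ Icc (0 : ℝ) 1, ∀ t ∈ Icc (0 : ℝ) 1, dist (f s) (f t) ≤ L * |s - t|) ∧
      TendstoUniformlyOn (fun n => F (φ n)) f atTop (Icc 0 1) := by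
  have hlip : ∀ n, LipschitzWith L.toNNReal (fun s : Icc (0 : ℝ) 1 => F n s) := fun n =>
    LipschitzWith.of_dist_le_mul fun s t => by
      rw [Real.coe_toNNReal L hL]
      exact hF n s s.2 t t.2
  let G : ℕ → BoundedContinuousFunction (Icc (0 : ℝ) 1) S := fun n =>
    BoundedContinuousFunction.mkOfCompact ⟨_, (hlip n).continuous⟩
  have hequi : Equicontinuous ((↑) : range G → Icc (0 : ℝ) 1 → S) := by
    refine (LipschitzWith.uniformEquicontinuous _ L.toNNReal ?_).equicontinuous
    rintro ⟨_, n, rfl⟩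
    exact hlip n
  have hcpt := BoundedContinuousFunction.arzela_ascoli K hK (range G)
    (by rintro _ s ⟨n, rfl⟩; exact hFK n s s.2) hequi
  obtain ⟨g, -, φ, hφ, hg⟩ := hcpt.tendsto_subseq fun n => subset_closure (mem_range_self n)
  have hunif : TendstoUniformlyOn (fun n => F (φ n)) (IccExtend zero_le_one g) atTop
      (Icc 0 1) := by
    refine Metric.tendstoUniformlyOn_iff.2 fun e he => ?_
    filter_upwards [Metric.tendstoUniformly_iff.1
      (BoundedContinuousFunction.tendsto_iff_tendstoUniformly.1 hg) e he] with n hn s hs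
    rw [IccExtend_of_mem _ _ hs]
    exact hn ⟨s, hs⟩
  refine ⟨φ, IccExtend zero_le_one g, hφ, fun s hs t ht => ?_, hunif⟩
  exact le_of_tendsto' ((hunif.tendsto_at hs).dist (hunif.tendsto_at ht))
    fun n => hF (φ n) s hs t ht

/-- After an elapsed time `p`, curves of durations `a` and `b`, rescaled to `[0, 1]` and stopped at
their ends, are at parameters that differ by at most `|a - b| / b`. -/
theorem abs_min_div_sub_min_div_le {a b p : ℝ} (ha : 0 < a) (hb : 0 < b) (hp : 0 ≤ p) :
    |min (p / a) 1 - min (p / b) 1| ≤ |a - b| / b := by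
  have key : ∀ u v : ℝ, 0 < u → u ≤ v →
      0 ≤ min (p / u) 1 - min (p / v) 1 ∧ min (p / u) 1 - min (p / v) 1 ≤ (v - u) / v := by
    intro u v hu huv
    have hv := hu.trans_le huv
    have h1 : p / v ≤ p / u := div_le_div_of_nonneg_left hp hu huv
    refine ⟨sub_nonneg.2 (min_le_min_right 1 h1), ?_⟩
    have h2 : (v - u) / v = 1 - u / v := by rw [sub_div, div_self hv.ne']
    have h3 : u / v ≤ 1 := (div_le_one hv).2 huv
    have h4 : p / v = p / u * (u / v) := by field_simp
    have h5 : 0 ≤ u / v := by positivity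
    have h6 : 0 ≤ p / u := by positivity
    rw [h2, h4]
    rcases le_total (p / u) 1 with h | h
    · rw [min_eq_left h, min_eq_left (by nlinarith)]
      nlinarith
    · rw [min_eq_right h]
      rcases le_total (p / u * (u / v)) 1 with h' | h'
      · rw [min_eq_left h']
        nlinarith
      · rw [min_eq_right h']
        linarith
  rcases le_total a b with h | h
  · obtain ⟨h1, h2⟩ := key a b ha h
    rwa [abs_of_nonneg h1, abs_sub_comm, abs_of_nonneg (sub_nonneg.2 h)]
  · obtain ⟨h1, h2⟩ := key b a hb h
    rw [abs_sub_comm, abs_of_nonneg h1, abs_of_nonneg (sub_nonneg.2 h)]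
    exact h2.trans (div_le_div_of_nonneg_left (sub_nonneg.2 h) hb h)

/-- Uniform convergence after rescaling to `[0, 1]` gives uniform convergence of the curves,
continued by constants after their final times. -/
theorem tendstoUniformlyOn_Ici_of_rescaled {a L d₀ : ℝ} {d : ℕ → ℝ} {σ : ℕ → ℝ → S} {f : ℝ → S}
    (hdpos : ∀ n, 0 < d n) (hd₀ : 0 < d₀) (hdlim : Tendsto d atTop (𝓝 d₀)) (hL : 0 ≤ L)
    (hf : ∀ s ∈ Icc (0 : ℝ) 1, ∀ t ∈ Icc (0 : ℝ) 1, dist (f s) (f t) ≤ L * |s - t|)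
    (hlim : TendstoUniformlyOn (fun n s => σ n (a + d n * s)) f atTop (Icc 0 1)) :
    TendstoUniformlyOn (fun n t => (σ n (min t (a + d n)), t))
      (fun t => (f ((min t (a + d₀) - a) / d₀), t)) atTop (Ici a) := by
  have h1 : Tendsto (fun n => L * (|d n - d₀| / d₀)) atTop (𝓝 0) := by
    have h2 : Tendsto (fun n => |d n - d₀|) atTop (𝓝 0) := by
      simpa using (hdlim.sub_const d₀).abs
    simpa using (h2.div_const d₀).const_mul L
  have hmin : ∀ c t : ℝ, 0 < c → (min t (a + c) - a) / c = min ((t - a) / c) 1 := by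
    intro c t hc
    rw [← min_sub_sub_right, add_sub_cancel_left, ← min_div_div_right hc.le, div_self hc.ne']
  have hIcc : ∀ c t : ℝ, 0 < c → a ≤ t → min ((t - a) / c) 1 ∈ Icc (0 : ℝ) 1 := fun c t hc ht =>
    ⟨le_min (div_nonneg (sub_nonneg.2 ht) hc.le) zero_le_one, min_le_right _ _⟩
  refine Metric.tendstoUniformlyOn_iff.2 fun e he => ?_
  filter_upwards [Metric.tendstoUniformlyOn_iff.1 hlim (e / 2) (half_pos he),
    h1.eventually (gt_mem_nhds (half_pos he))] with n hn hn' t ht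
  rw [Prod.dist_eq, dist_self, max_eq_left dist_nonneg, hmin d₀ t hd₀]
  have h3 : min t (a + d n) = a + d n * min ((t - a) / d n) 1 := by
    rw [← hmin (d n) t (hdpos n), mul_div_cancel₀ _ (hdpos n).ne', add_sub_cancel]
  rw [h3]
  have h4 := hn _ (hIcc (d n) t (hdpos n) ht)
  have h5 := hf _ (hIcc d₀ t hd₀ ht) _ (hIcc (d n) t (hdpos n) ht)
  have h6 : L * |min ((t - a) / d₀) 1 - min ((t - a) / d n) 1| ≤ L * (|d n - d₀| / d₀) := by
    rw [abs_sub_comm]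
    exact mul_le_mul_of_nonneg_left
      (abs_min_div_sub_min_div_le (hdpos n) hd₀ (sub_nonneg.2 ht)) hL
  linarith [dist_triangle (f (min ((t - a) / d₀) 1)) (f (min ((t - a) / d n) 1))
    (σ n (a + d n * min ((t - a) / d n) 1))]

end Compactness

end

/-! ### Convergence of the light rays -/

theorem mainTheorem4
    {E : Type*} [NormedAddCommGroup E] [NormedSpace ℝ E] [FiniteDimensional ℝ E]
    (hdim : 2 ≤ Module.finrank ℝ E)
    {S : Type*} [MetricSpace S] [ConnectedSpace S] [ChartedSpace E S] [IsManifold 𝓘(ℝ, E) ∞ S]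
    [RiemannianBundle (fun x : S => TangentSpace 𝓘(ℝ, E) x)]
    [IsContMDiffRiemannianBundle 𝓘(ℝ, E) ∞ E (fun x : S => TangentSpace 𝓘(ℝ, E) x)]
    [IsRiemannianManifold 𝓘(ℝ, E) S]
    (η : ∀ x : S, TangentSpace 𝓘(ℝ, E) x →L[ℝ] ℝ)
    (hη : ContMDiff 𝓘(ℝ, E) (𝓘(ℝ, E).prod 𝓘(ℝ, E →L[ℝ] ℝ)) ∞
      (fun x => TotalSpace.mk' (E →L[ℝ] ℝ) (E := fun x : S => TangentSpace 𝓘(ℝ, E) x →L[ℝ] ℝ)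
        x (η x)))
    (hη_ne : ∀ x, η x ≠ 0)
    (Λ : S → ℝ) (hΛ : ContMDiff 𝓘(ℝ, E) 𝓘(ℝ, ℝ) ∞ Λ) (hΛ_nonneg : ∀ x, 0 ≤ Λ x)
    (hstar : StarCondition η Λ)
    (x₀ x₁ : S) (t₀ : ℝ) (ε : ℕ → ℝ) (hε_pos : ∀ n, 0 < ε n) (hε : Tendsto ε atTop (𝓝 0))
    (Δ : ℕ → ℝ) (hΔ_pos : ∀ n, 0 < Δ n) (Δlim : ℝ) (hΔ : Tendsto Δ atTop (𝓝 Δlim))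
    (σ : ℕ → ℝ → S) (hσ₀ : ∀ n, σ n t₀ = x₀) (hσ₁ : ∀ n, σ n (t₀ + Δ n) = x₁)
    (hgeo : ∀ n, IsPregeodesicOn (stationaryMetric η Λ (ε n)) (fun t => (σ n t, t))
      t₀ (t₀ + Δ n))
    (hlight : ∀ n, IsLightlikeOn (stationaryMetric η Λ (ε n)) (fun t => (σ n t, t))
      t₀ (t₀ + Δ n)) :
    ∃ (φ : ℕ → ℕ) (σlim : ℝ → S), StrictMono φ ∧
      -- uniform convergence of the curves, each continued after its final time by the constant
      -- value `x₁` of its component in `S`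
      TendstoUniformlyOn (fun n t => (σ (φ n) (min t (t₀ + Δ (φ n))), t))
        (fun t => (σlim (min t (t₀ + Δlim)), t)) atTop (Ici t₀) ∧
      σlim t₀ = x₀ ∧ σlim (t₀ + Δlim) = x₁ ∧
      IsPregeodesicOn (stationaryMetric η Λ 0) (fun t => (σlim t, t)) t₀ (t₀ + Δlim) ∧
      IsLightlikeOn (stationaryMetric η Λ 0) (fun t => (σlim t, t)) t₀ (t₀ + Δlim) ∧
      IsFuturePointingOn (stationaryMetric η Λ 0) (fun t => (σlim t, t)) t₀ (t₀ + Δlim) := by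
  have hd := fun p : S => isStationaryData_chart hη hη_ne hΛ hΛ_nonneg p
  obtain ⟨δ, ⟨hδ0, hδ1⟩, hcompact⟩ := hstar
  obtain ⟨N, hN⟩ := eventually_atTop.1 (hε.eventually (gt_mem_nhds hδ0))
  have hab : ∀ n, t₀ < t₀ + Δ n := fun n => by linarith [hΔ_pos n]
  have hsm : ∀ n, ContMDiffOn 𝓘(ℝ, ℝ) 𝓘(ℝ, E) ∞ (σ n) (Icc t₀ (t₀ + Δ n)) := fun n =>
    contMDiff_fst.comp_contMDiffOn (hgeo n).1
  have hnull : ∀ n, HasNullGraph η Λ (ε n) (σ n) t₀ (t₀ + Δ n) := fun n =>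
    (hlight n).hasNullGraph (hab n) (hsm n)
  choose κ hκ using fun n => (hgeo n).exists_solvesRayEquation hd (hε_pos n).le (hab n)
  -- the curves with `ε n ≤ δ` stay in one of the compact sets of condition (⋆)
  obtain ⟨R, hR⟩ := hΔ.bddAbove_range
  have hR : ∀ n, Δ n ≤ R := fun n => hR (mem_range_self n)
  have hR0 : 0 < R := (hΔ_pos 0).trans_le (hR 0)
  set K := closure (forwardBall η Λ δ x₀ (R + 1)) ∩ closure (backwardBall η Λ δ x₁ (R + 1))
  have hK : IsCompact K := hcompact x₀ x₁ _ _ (by linarith) (by linarith)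
  have hmemK : ∀ n, ∀ t ∈ Icc t₀ (t₀ + Δ (n + N)), σ (n + N) t ∈ K := fun n t ht => by
    have h := mem_forwardBall_inter_backwardBall (hN (n + N) (Nat.le_add_left _ _)).le
      (hsm (n + N)) (hnull (n + N)) (r := R + 1) (by linarith) (by linarith [hR (n + N)]) ht
    rw [hσ₀, hσ₁] at h
    exact ⟨subset_closure h.1, subset_closure h.2⟩
  have hεmem : ∀ n, ε (n + N) ∈ Ioc (0 : ℝ) 1 := fun n =>
    ⟨hε_pos _, (hN (n + N) (Nat.le_add_left _ _)).le.trans hδ1⟩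
  obtain ⟨C, hC0, hC⟩ := exists_norm_le_of_null hd hK
  have hlip : ∀ n, ∀ s ∈ Icc t₀ (t₀ + Δ (n + N)), ∀ t ∈ Icc t₀ (t₀ + Δ (n + N)),
      dist (σ (n + N) s) (σ (n + N) t) ≤ C * |s - t| := fun n s hs t ht =>
    dist_le_of_norm_velocityOn_le hC0 (hsm _)
      (fun r hr => hC _ (hmemK n r hr) _ (hεmem n).2 _ (hnull _ r hr)) hs ht
  have hΔN : Tendsto (fun n => Δ (n + N)) atTop (𝓝 Δlim) := hΔ.comp (tendsto_add_atTop_nat N)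
  have hΔlim : 0 < Δlim := pos_of_tendsto_duration hd hC0 (fun n => hΔ_pos (n + N)) hΔN hεmem
    (fun n => (hsm (n + N)).continuousOn) (fun n => hκ (n + N)) (fun n => hnull (n + N)) hlip
    (fun n => hσ₀ (n + N)) (fun n => hσ₁ (n + N))
  -- a uniformly convergent subsequence of the curves rescaled to `[0, 1]`
  have hmaps : ∀ n, ∀ s ∈ Icc (0 : ℝ) 1, t₀ + Δ n * s ∈ Icc t₀ (t₀ + Δ n) := fun n s hs =>
    ⟨by nlinarith [hΔ_pos n, hs.1], by nlinarith [hΔ_pos n, hs.2]⟩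
  obtain ⟨ψ, f, hψ, hf, hunif⟩ := exists_subseq_tendstoUniformlyOn_Icc hK
    (mul_nonneg hC0 hR0.le) (F := fun n s => σ (n + N) (t₀ + Δ (n + N) * s))
    (fun n s hs => hmemK n _ (hmaps _ s hs)) fun n s hs t ht => by
      refine (hlip n _ (hmaps _ s hs) _ (hmaps _ t ht)).trans ?_
      rw [add_sub_add_left_eq_sub, ← mul_sub, abs_mul, abs_of_pos (hΔ_pos _), mul_assoc]
      gcongr
      exact hR _
  have hfc : ContinuousOn f (Icc 0 1) :=
    (LipschitzOnWith.of_dist_le_mul (K := (C * R).toNNReal) fun s hs t ht => by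
      rw [Real.coe_toNNReal _ (mul_nonneg hC0 hR0.le)]
      exact hf s hs t ht).continuousOn
  have hf0 : f 0 = x₀ := tendsto_nhds_unique (hunif.tendsto_at (left_mem_Icc.2 zero_le_one))
    (by simp [hσ₀])
  have hf1 : f 1 = x₁ := tendsto_nhds_unique (hunif.tendsto_at (right_mem_Icc.2 zero_le_one))
    (by simp [hσ₁])
  have hψN : Tendsto (fun n => ψ n + N) atTop atTop :=
    (tendsto_add_atTop_nat N).comp hψ.tendsto_atTop
  obtain ⟨hcont, ⟨κ₀, hκ₀⟩, hnull₀⟩ := exists_solvesRayEquation_of_tendstoUniformlyOn hd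
    (fun n => hΔ_pos (ψ n + N)) hΔlim (hΔ.comp hψN) (fun n => Ioc_subset_Icc_self (hεmem (ψ n)))
    (hε.comp hψN) (fun n => (hsm (ψ n + N)).continuousOn) (fun n => hκ (ψ n + N))
    (fun n => hnull (ψ n + N)) hfc hunif
  have hpre := hκ₀.isPregeodesicOn hd le_rfl (by linarith) hcont
  have hsmooth := contMDiff_fst.comp_contMDiffOn hpre.1
  exact ⟨fun n => ψ n + N, fun t => f ((t - t₀) / Δlim), fun m n h => Nat.add_lt_add_right (hψ h) N,
    tendstoUniformlyOn_Ici_of_rescaled (fun n => hΔ_pos (ψ n + N)) hΔlim (hΔ.comp hψN)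
      (mul_nonneg hC0 hR0.le) hf hunif,
    by simp [hf0], by simp [hf1, hΔlim.ne'], hpre,
    hnull₀.isLightlikeOn (by linarith) hsmooth, hnull₀.isFuturePointingOn (by linarith) hsmooth⟩
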